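/- **Poincaré inequality with zero boundary average.** Let $d\in\{2,3\}$. A *polytopal element* $K\subset\mathbb R^d$ is a polygon ($d=2$) or polyhedron ($d=3$), not necessarily convex: a finite union of convex polytopes that is the closure of its non-empty connected interior, whose boundary does not intersect itself (it is a topological $(d-1)$-manifold) and is the union of a finite set $\mathcal F(K)$ of closed flat $(d-1)$-dimensional polytopal faces with connected, pairwise disjoint relative interiors; neighbouring faces may be coplanar. Put $n_K=|\mathcal F(K)|$, let $h_D$ be the diameter of a set $D$, and let $\operatorname{conv}(K)$ be the convex hull of $K$. For a face $F$ of $K$ with unit normal $\boldsymbol n$ pointing into $K$, a set $G\subseteq F$ and $I\subseteq\mathbb R$, write $G\times I=\{\boldsymbol x+\tau\boldsymbol n:\boldsymbol x\in G,\tau\in I\}$, and set $$\delta_G=\inf\{\tau>0: K\cap(G\times(\tau,\infty))=\varnothing\},\qquad P(G,\boldsymbol p)=\{(1-t)\boldsymbol x+t\boldsymbol p:\ \boldsymbol x\in G,\ t\in(0,1)\},$$ $$l_G=\sup\{l>0:\ \exists\,\boldsymbol p\in\mathbb R^d,\ \operatorname{dist}(\boldsymbol p,G)=l,\ P(G,\boldsymbol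 p)\subseteq K\cap(G\times(0,\delta_G])\}$$ (with $l_G=0$ if there is no such $l$). Let $N,M\in\mathbb N$ and $\gamma>0$, and consider the conditions * **(A)** $n_K\le N$; * **(B)** (height condition) every face $F\in\mathcal F(K)$ is the union of at most $M$ measurable pieces $F_\beta$, pairwise overlapping only in sets of surface measure zero, such that $l_{F_\beta}\ge\gamma\, h_F$ for every $\beta$. Then there is a constant $C>0$ depending only on $d,N,M,\gamma$ such that for every polytopal element $K\subset\mathbb R^d$ satisfying (A) and (B) and every real-valued $v\in H^1(\operatorname{conv}(K))$, the function $v$ has a trace in $L^2(\partial K)$ and $$\big\|v-\overline v^{\,\partial K}\big\|_{L^2(K)}\ \le\ C\,h_K\,\|\nabla v\|_{L^2(\operatorname{conv}(K))},\qquad \overline v^{\,\partial K}=\frac1{|\partial K|}\int_{\partial K}v\,\mathrm dS .$$ Here $H^1(\operatorname{conv}(K))$ is the space of square-integrable functions with square-integrable weak gradient on the interior of $\operatorname{conv}(K)$. A trace of $v$ on $\partial K$ is a limit in $L^2(\partial K)$ of $\varphi_n|_{\partial K}$ for some smooth functions $\varphi_n$ on $\mathbb R^d$ with $\varphi_n\to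 v$ in $H^1(\operatorname{conv}(K))$; the inequality holds with $\overline v^{\,\partial K}$ computed from any such trace. -/

import Mathlib

open MeasureTheory Filter Topology Set

noncomputable section

namespace Polytopal

/-- `d`-dimensional Euclidean space. -/
abbrev E (d : ℕ) : Type := EuclideanSpace ℝ (Fin d)

/-! ### Polytopes -/

/-- A (closed, bounded, not necessarily convex) flat polytopal region of dimension `k` in `ℝᵈ`:
a finite union of convex hulls of finite sets whose affine span has dimension `k`, which is the
closure of its relative interior, the relative interior being connected (and non-empty).
For `k = d` the relative interior is the interior. -/
structure IsPolytopalRegion {d : ℕ} (k : ℕ) (S : Set (E d)) : Prop where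
  finite_union : ∃ P : Finset (Finset (E d)), S = ⋃ s ∈ P, convexHull ℝ (s : Set (E d))
  finrank_span : Module.finrank ℝ (affineSpan ℝ S).direction = k
  closure_interior : closure (intrinsicInterior ℝ S) = S
  connected : IsConnected (intrinsicInterior ℝ S)

/-- A polygon (`d = 2`) or polyhedron (`d = 3`) without self-intersections, together with the
finite list of its `(d-1)`-dimensional flat faces. Neighbouring faces may lie in the same
hyperplane, as happens for elements of a mesh with hanging nodes. -/
structure Polytope (d : ℕ) where
  /-- the closed polytope as a set of points -/
  carrier : Set (E d)
  region : IsPolytopalRegion d carrier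
  /-- the boundary does not intersect itself: it is a topological `(d-1)`-manifold -/
  simple : ∀ x ∈ frontier carrier, ∃ U : Set (E d), IsOpen U ∧ x ∈ U ∧
    Nonempty (↥(frontier carrier ∩ U) ≃ₜ E (d - 1))
  /-- the flat faces -/
  faces : Finset (Set (E d))
  face_region : ∀ F ∈ faces, IsPolytopalRegion (d - 1) F
  face_disjoint : ∀ F ∈ faces, ∀ G ∈ faces, F ≠ G →
    Disjoint (intrinsicInterior ℝ F) (intrinsicInterior ℝ G)
  iUnion_faces : ⋃ F ∈ faces, F = frontier carrier

/-- `(d-1)`-dimensional surface measure, normalised to be Lebesgue measure on hyperplanes. -/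
def surfaceMeasure (d : ℕ) : Measure (E d) := Measure.euclideanHausdorffMeasure (d - 1)

/-- `n` is the unit normal of the face `F` of `K` pointing into `K`. -/
structure IsInwardNormal {d : ℕ} (K F : Set (E d)) (n : E d) : Prop where
  norm_eq_one : ‖n‖ = 1
  orthogonal : ∀ u ∈ (affineSpan ℝ F).direction, inner ℝ n u = 0
  inward : ∀ x ∈ intrinsicInterior ℝ F,
    ∀ᶠ t : ℝ in 𝓝[>] 0, x + t • n ∈ interior K ∧ x - t • n ∉ K

/-- The prism `F × I` over `F`, in the coordinate system whose last axis is directed by `n`. -/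
def prism {d : ℕ} (F : Set (E d)) (n : E d) (I : Set ℝ) : Set (E d) :=
  {y | ∃ x ∈ F, ∃ τ ∈ I, y = x + τ • n}

/-- `δ_F = inf {τ > 0 : K ∩ (F × (τ, ∞)) = ∅}`. -/
def depth {d : ℕ} (K F : Set (E d)) (n : E d) : ℝ :=
  sInf {τ : ℝ | 0 < τ ∧ K ∩ prism F n (Ioi τ) = ∅}

/-- The pyramid with base `F` and apex `p`. -/
def pyramid {d : ℕ} (F : Set (E d)) (p : E d) : Set (E d) :=
  {y | ∃ x ∈ F, ∃ t ∈ Ioo (0 : ℝ) 1, y = (1 - t) • x + t • p}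

/-- The heights of the pyramids with base `F` that are contained in `K ∩ (F × (0, δ_F])`. -/
def heightSet {d : ℕ} (K F : Set (E d)) (n : E d) : Set ℝ :=
  {l | 0 < l ∧ ∃ p : E d, Metric.infDist p F = l ∧
    pyramid F p ⊆ K ∩ prism F n (Ioc 0 (depth K F n))}

/-- The inward height `l_F`: the supremum of the heights of these pyramids. -/
def inwardHeight {d : ℕ} (K F : Set (E d)) (n : E d) : ℝ := sSup (heightSet K F n)

/-- The height condition with constants `γ` and `M`: every face `F` has a partition into at most
`M` pieces (up to overlaps of surface measure zero), each of which has inward height at least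
`γ h_F`, where `h_F` is the diameter of the whole face. -/
def HeightCondition {d : ℕ} (K : Polytope d) (γ : ℝ) (M : ℕ) : Prop :=
  ∀ F ∈ K.faces, ∃ n : E d, IsInwardNormal K.carrier F n ∧
    ∃ B : Finset (Set (E d)), B.card ≤ M ∧ ⋃ G ∈ B, G = F ∧
      (∀ G ∈ B, MeasurableSet G) ∧
      (∀ G ∈ B, ∀ G' ∈ B, G ≠ G' → surfaceMeasure d (G ∩ G') = 0) ∧
      ∀ G ∈ B, γ * Metric.diam F ≤ inwardHeight K.carrier G n

/-! ### Sobolev functions and their traces -/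

/-- `v ∈ H¹(D)` with weak gradient `g` (`D` open): both are square integrable on `D` and
`∫ v ∇φ = - ∫ φ g` for all test functions `φ ∈ C_c^∞(D)`. -/
structure IsH1 {d : ℕ} (D : Set (E d)) (v : E d → ℝ) (g : E d → E d) : Prop where
  memLp : MemLp v 2 (volume.restrict D)
  memLp_grad : MemLp g 2 (volume.restrict D)
  weak_grad : ∀ φ : E d → ℝ, ContDiff ℝ ((⊤ : ℕ∞) : WithTop ℕ∞) φ → HasCompactSupport φ →
    tsupport φ ⊆ D → ∫ x in D, v x • gradient φ x = - ∫ x in D, φ x • g x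

/-- The interior of the convex hull of `K`. It differs from the convex hull by a null set. -/
def hull {d : ℕ} (K : Polytope d) : Set (E d) := interior (convexHull ℝ K.carrier)

/-- Surface measure on the boundary of `K`. -/
def boundaryMeasure {d : ℕ} (K : Polytope d) : Measure (E d) :=
  (surfaceMeasure d).restrict (frontier K.carrier)

/-- `w ∈ L²(∂K)` is the trace on `∂K` of `v ∈ H¹(conv K)`, `∇v = g`: the trace is the continuous
extension to `H¹(conv K)` of the restriction of smooth functions to `∂K`, that is, there are
smooth `φₙ` with `φₙ → v` in `H¹(conv K)` and `φₙ → w` in `L²(∂K)`. -/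
def IsTrace {d : ℕ} (K : Polytope d) (v : E d → ℝ) (g : E d → E d) (w : E d → ℝ) : Prop :=
  MemLp w 2 (boundaryMeasure K) ∧
  ∃ φ : ℕ → E d → ℝ, (∀ n, ContDiff ℝ ((⊤ : ℕ∞) : WithTop ℕ∞) (φ n)) ∧
    Tendsto (fun n => eLpNorm (fun x => φ n x - v x) 2 (volume.restrict (hull K))) atTop (𝓝 0) ∧
    Tendsto (fun n => eLpNorm (fun x => gradient (φ n) x - g x) 2 (volume.restrict (hull K)))
      atTop (𝓝 0) ∧
    Tendsto (fun n => eLpNorm (fun x => φ n x - w x) 2 (boundaryMeasure K)) atTop (𝓝 0)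

end Polytopal

end

/-! ### Hyperplanes, projections and slabs. -/

namespace Polytopal

/-! For smooth `φ`, Jensen's inequality reduces the claim to a bound on the integral of `|φ x - φ
y|²` over `x ∈ K` and `y` in a face `F`. Along the segment from `y` to `x`, which stays in the
convex hull, this is at most `h_K²` times the integral of `|∇φ|²`. Each segment is cut at its
midpoint, and each half is integrated first over the endpoint it is closer to, so that this endpoint
is scaled by at least `1/2`. Only the half next to `F` is delicate: its change of variables costs
the inverse of the distance from `x` to the plane of `F`, which may be arbitrarily small.

The remedy is to compare `x` and `y` through a third point `a` in the set `A` of points of `K` at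
distance at least `s = |K| / (4 |∂K|)` from that plane. Every line that meets `K` meets `∂K`, so the
projection of `K` to the plane has measure at most `|∂K|`. Hence the slab of half-width `s` contains
at most half of `K` (`volume_slab_le`), and `|A| ≥ |K| / 2`. The cost `1/s` is then compensated by
`|A| ≤ |K|`, leaving a factor `|∂K|` (`lintegral_sub_sq_face_le`). Summing over the faces and
dividing by `|∂K|` gives the inequality with a constant that involves only the number of faces and
the dimension.

The same double integral yields a trace inequality (`exists_trace_inequality`). Smooth functions are
dense in `H¹` of the open hull, by contracting towards an interior point and mollifying
(`exists_contDiff_tendsto`). So traces exist by completeness, and the estimate passes to the limit.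
-/

/-- Change of variables `x ↦ r x + b` in a finite-dimensional space. -/
lemma lintegral_comp_smul_add {V : Type*} [NormedAddCommGroup V] [NormedSpace ℝ V]
    [MeasurableSpace V] [BorelSpace V] [FiniteDimensional ℝ V] (μ : Measure V)
    [μ.IsAddHaarMeasure] (f : V → ENNReal) {r : ℝ} (hr : r ≠ 0) (b : V) :
    ∫⁻ x, f (r • x + b) ∂μ = ENNReal.ofReal |(r ^ Module.finrank ℝ V)⁻¹| * ∫⁻ x, f x ∂μ := by
  have h1 := lintegral_map_equiv (μ := μ) (fun x => f (x + b))
    (Homeomorph.smulOfNeZero r hr).toMeasurableEquiv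
  have h2 : Measure.map (Homeomorph.smulOfNeZero r hr).toMeasurableEquiv μ
      = ENNReal.ofReal |(r ^ Module.finrank ℝ V)⁻¹| • μ := Measure.map_addHaar_smul μ hr
  rw [h2, lintegral_smul_measure, lintegral_add_right_eq_self] at h1
  exact h1.symm

/-- The threshold `1/2` is what cutting segments at their midpoint provides. -/
lemma lintegral_comp_smul_add_le {V : Type*} [NormedAddCommGroup V] [NormedSpace ℝ V]
    [MeasurableSpace V] [BorelSpace V] [FiniteDimensional ℝ V] (μ : Measure V)
    [μ.IsAddHaarMeasure] (f : V → ENNReal) {r : ℝ} (hr : 1 / 2 ≤ r) (b : V) :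
    ∫⁻ x, f (r • x + b) ∂μ ≤ 2 ^ Module.finrank ℝ V * ∫⁻ x, f x ∂μ := by
  have hr0 : 0 < r := by linarith
  rw [lintegral_comp_smul_add μ f hr0.ne']
  gcongr
  have h2 : (2 : ENNReal) ^ Module.finrank ℝ V = ENNReal.ofReal (2 ^ Module.finrank ℝ V) := by
    rw [ENNReal.ofReal_pow (by norm_num)]
    norm_num
  rw [h2]
  apply ENNReal.ofReal_le_ofReal
  rw [abs_of_pos (by positivity), ← inv_pow]
  gcongr
  rw [inv_le_comm₀ hr0 (by norm_num)]
  linarith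

/-! ### Coordinates adapted to a hyperplane -/

/-- Coordinates on `ℝᵈ` with one axis along `n` and the others in the hyperplane `n^⊥`. -/
def flatMap {d : ℕ} (q n : E d) (p : ℝ × ↥(ℝ ∙ n)ᗮ) : E d := p.1 • n + (p.2 : E d) + q

lemma measurePreserving_flatMap {d : ℕ} (q n : E d) (hn : ‖n‖ = 1) :
    MeasurePreserving (flatMap q n) volume volume := by
  have h1 := ((ℝ ∙ n).measurePreserving_measurableEquivProd q).symm
  rw [InnerProductSpace.euclideanHausdorffMeasure_eq_volume] at h1
  have h2 := (LinearIsometryEquiv.toSpanUnitSingleton (𝕜 := ℝ) n hn).measurePreserving.prod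
    (MeasurePreserving.id (volume : Measure ↥(ℝ ∙ n)ᗮ))
  have h3 := h1.comp h2
  have h4 : flatMap q n = (((ℝ ∙ n).measurableEquivProd q).symm) ∘
      Prod.map (LinearIsometryEquiv.toSpanUnitSingleton (𝕜 := ℝ) n hn) id := by
    ext1 p
    simp [flatMap]
  rw [h4]
  exact h3

lemma isometry_vadd_subspace {d : ℕ} (q : E d) (W : Submodule ℝ (E d)) :
    Isometry (fun y : W => (y : E d) + q) :=
  (IsometryEquiv.addRight q).isometry.comp isometry_subtype_coe

lemma finrank_orthogonal_span {m : ℕ} {n : E (m + 1)} (hn : ‖n‖ = 1) :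
    Module.finrank ℝ ↥(ℝ ∙ n)ᗮ = m := by
  have h := (ℝ ∙ n).finrank_add_finrank_orthogonal
  have hn0 : n ≠ 0 := by rintro rfl; simp at hn
  rw [finrank_span_singleton hn0] at h
  simp at h
  omega

/-- Normalised Hausdorff measure is preserved by isometries and is Lebesgue measure on a Euclidean
space of its own dimension. -/
lemma map_volume_hyperplane {m : ℕ} (q : E (m + 1)) {n : E (m + 1)} (hn : ‖n‖ = 1) :
    Measure.map (fun y : ↥(ℝ ∙ n)ᗮ => (y : E (m + 1)) + q) volume
      = (surfaceMeasure (m + 1)).restrict (range fun y : ↥(ℝ ∙ n)ᗮ => (y : E (m + 1)) + q) := by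
  have h := (isometry_vadd_subspace q (ℝ ∙ n)ᗮ).map_euclideanHausdorffMeasure (d := m)
  have h2 := InnerProductSpace.euclideanHausdorffMeasure_eq_volume (V := ↥(ℝ ∙ n)ᗮ)
  rw [finrank_orthogonal_span hn] at h2
  rw [← h2, h]
  rfl

lemma setLIntegral_surfaceMeasure {m : ℕ} {q n : E (m + 1)} (hn : ‖n‖ = 1)
    {F : Set (E (m + 1))} (hF : MeasurableSet F)
    (hsub : F ⊆ range fun y : ↥(ℝ ∙ n)ᗮ => (y : E (m + 1)) + q) (f : E (m + 1) → ENNReal) :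
    ∫⁻ x in F, f x ∂surfaceMeasure (m + 1)
      = ∫⁻ y in (fun y : ↥(ℝ ∙ n)ᗮ => (y : E (m + 1)) + q) ⁻¹' F, f (y + q) := by
  have hemb : MeasurableEmbedding (fun y : ↥(ℝ ∙ n)ᗮ => (y : E (m + 1)) + q) :=
    (isometry_vadd_subspace q (ℝ ∙ n)ᗮ).isClosedEmbedding.measurableEmbedding
  rw [← inter_eq_self_of_subset_left hsub, ← Measure.restrict_restrict hF,
    ← map_volume_hyperplane q hn, hemb.restrict_map, hemb.lintegral_map,
    inter_eq_self_of_subset_left hsub]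

/-! ### Sections and projections of compact sets -/

/-- The parameters of the line that land in `K` form a non-empty bounded subset of the connected
space `ℝ`, which must have a frontier point. -/
lemma exists_mem_frontier_line {d : ℕ} {K : Set (E d)} (hK : IsCompact K) {x n : E d}
    (hx : x ∈ K) (hn : ‖n‖ = 1) : ∃ τ : ℝ, x + τ • n ∈ frontier K := by
  have hc : Continuous fun τ : ℝ => x + τ • n := by fun_prop
  have h1 : ((fun τ : ℝ => x + τ • n) ⁻¹' K).Nonempty := ⟨0, by simpa using hx⟩
  have h2 : (fun τ : ℝ => x + τ • n) ⁻¹' K ≠ univ := by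
    intro h
    obtain ⟨R, hR⟩ := hK.isBounded.exists_norm_le
    have h3 := hR (x + (‖x‖ + R + 1) • n) (by
      have : (‖x‖ + R + 1) ∈ (fun τ : ℝ => x + τ • n) ⁻¹' K := h ▸ mem_univ _
      exact this)
    have hR0 : 0 ≤ R := (norm_nonneg _).trans (hR x hx)
    have h4 : ‖(‖x‖ + R + 1) • n‖ ≤ ‖x + (‖x‖ + R + 1) • n‖ + ‖x‖ := by
      have := norm_sub_le (x + (‖x‖ + R + 1) • n) x
      simpa using this
    rw [norm_smul, hn, mul_one, Real.norm_of_nonneg (by positivity)] at h4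
    linarith
  obtain ⟨τ, hτ⟩ := nonempty_frontier_iff.2 ⟨h1, h2⟩
  exact ⟨τ, hc.frontier_preimage_subset K hτ⟩

/-- The orthogonal projection of a compact set to a hyperplane is at most as large as the
boundary of the set. -/
lemma volume_projection_le {m : ℕ} {K : Set (E (m + 1))} (hK : IsCompact K)
    (q : E (m + 1)) {n : E (m + 1)} (hn : ‖n‖ = 1) :
    volume ((fun x => (ℝ ∙ n)ᗮ.orthogonalProjectionOnto (x - q)) '' K)
      ≤ surfaceMeasure (m + 1) (frontier K) := by
  set f : E (m + 1) → ↥(ℝ ∙ n)ᗮ := fun x => (ℝ ∙ n)ᗮ.orthogonalProjectionOnto (x - q) with hf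
  have hlip : LipschitzWith 1 f := by
    have h1 : LipschitzWith 1 ((ℝ ∙ n)ᗮ.orthogonalProjectionOnto) :=
      ContinuousLinearMap.lipschitzWith_of_opNorm_le (by
        simpa using (ℝ ∙ n)ᗮ.orthogonalProjectionOnto_norm_le)
    have h2 : LipschitzWith 1 (fun x : E (m + 1) => x - q) := 
      (IsometryEquiv.subRight q).isometry.lipschitz
    have h3 := h1.comp h2
    rw [mul_one] at h3
    exact h3
  -- Moving along `n` does not change the projection, so each point of `K` can be moved to the
  -- frontier.
  have hsub : f '' K ⊆ f '' frontier K := by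
    rintro _ ⟨x, hx, rfl⟩
    obtain ⟨τ, hτ⟩ := exists_mem_frontier_line hK hx hn
    refine ⟨_, hτ, ?_⟩
    have h0 : (ℝ ∙ n)ᗮ.orthogonalProjectionOnto (τ • n) = 0 :=
        Submodule.orthogonalProjectionOnto_orthogonal_apply_eq_zero
          (Submodule.smul_mem _ τ (Submodule.mem_span_singleton_self n))
    simp only [hf]
    rw [add_sub_right_comm, map_add, h0, add_zero]
  have h2 := InnerProductSpace.euclideanHausdorffMeasure_eq_volume (V := ↥(ℝ ∙ n)ᗮ)
  rw [finrank_orthogonal_span hn] at h2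
  calc volume (f '' K) ≤ volume (f '' frontier K) := measure_mono hsub
    _ ≤ surfaceMeasure (m + 1) (frontier K) := by
      rw [← h2, surfaceMeasure, Measure.euclideanHausdorffMeasure_def,
        Measure.euclideanHausdorffMeasure_def]
      simp only [Measure.smul_apply, Nat.add_sub_cancel]
      gcongr
      simpa using hlip.hausdorffMeasure_image_le (d := m) (by positivity) (frontier K)

/-- A slab around a hyperplane contains at most the part `2 s |∂K|` of a compact set `K`. -/
lemma volume_slab_le {m : ℕ} {K : Set (E (m + 1))} (hK : IsCompact K)
    (q : E (m + 1)) {n : E (m + 1)} (hn : ‖n‖ = 1) (s : ℝ) :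
    volume (K ∩ {x | |inner ℝ n (x - q)| < s})
      ≤ ENNReal.ofReal (2 * s) * surfaceMeasure (m + 1) (frontier K) := by
  set f : E (m + 1) → ↥(ℝ ∙ n)ᗮ := fun x => (ℝ ∙ n)ᗮ.orthogonalProjectionOnto (x - q) with hf
  have hmeas : MeasurableSet (K ∩ {x | |inner ℝ n (x - q)| < s}) := by
    apply hK.measurableSet.inter
    exact (isOpen_lt (by fun_prop) continuous_const).measurableSet
  -- In adapted coordinates the slab part of `K` lies in a product of an interval of length `2 s`
  -- and the projection of `K`.
  have hsub : flatMap q n ⁻¹' (K ∩ {x | |inner ℝ n (x - q)| < s}) ⊆ Ioo (-s) s ×ˢ (f '' K) := by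
    rintro ⟨τ, y⟩ ⟨h1, h2⟩
    have hy : inner ℝ n (y : E (m + 1)) = 0 :=
      Submodule.mem_orthogonal_singleton_iff_inner_right.1 y.2
    refine ⟨?_, _, h1, ?_⟩
    · simp only [flatMap, mem_ofPred_eq, add_sub_cancel_right, inner_add_right, inner_smul_right,
        hy, real_inner_self_eq_norm_sq, hn] at h2
      simpa [abs_lt] using h2
    · have h0 : (ℝ ∙ n)ᗮ.orthogonalProjectionOnto (τ • n) = 0 :=
        Submodule.orthogonalProjectionOnto_orthogonal_apply_eq_zero
          (Submodule.smul_mem _ τ (Submodule.mem_span_singleton_self n))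
      simp only [hf, flatMap, add_sub_cancel_right, map_add, h0, zero_add]
      exact Submodule.orthogonalProjectionOnto_mem_subspace_eq_self y
  rw [← (measurePreserving_flatMap q n hn).measure_preimage hmeas.nullMeasurableSet]
  refine (measure_mono hsub).trans ?_
  rw [Measure.volume_eq_prod, Measure.prod_prod, Real.volume_Ioo, sub_neg_eq_add, ← two_mul]
  gcongr
  exact volume_projection_le hK q hn

end Polytopal

/-! ### Squared differences and gradients along segments. -/

namespace Polytopal

/-! ### Squared `L²` norms -/

lemma eLpNorm_two_sq {α G : Type*} [MeasurableSpace α] [NormedAddCommGroup G] (μ : Measure α)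
    (f : α → G) : eLpNorm f 2 μ ^ 2 = ∫⁻ x, ‖f x‖ₑ ^ 2 ∂μ := by
  have h := eLpNorm_nnreal_pow_eq_lintegral (μ := μ) (f := f) (p := 2) (by norm_num)
  simpa using h

/-- Jensen's inequality for the square of the norm. -/
lemma enorm_integral_sq_le {α G : Type*} [MeasurableSpace α] [NormedAddCommGroup G]
    [NormedSpace ℝ G] {μ : Measure α} [IsProbabilityMeasure μ] {f : α → G}
    (hf : AEStronglyMeasurable f μ) : ‖∫ x, f x ∂μ‖ₑ ^ 2 ≤ ∫⁻ x, ‖f x‖ₑ ^ 2 ∂μ := by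
  rw [← eLpNorm_two_sq]
  gcongr
  calc ‖∫ x, f x ∂μ‖ₑ ≤ eLpNorm f 1 μ := by
        rw [eLpNorm_one_eq_lintegral_enorm]
        exact enorm_integral_le_lintegral_enorm f
    _ ≤ eLpNorm f 2 μ := eLpNorm_le_eLpNorm_of_exponent_le (by norm_num) hf

lemma enorm_sub_sq_le {G : Type*} [NormedAddCommGroup G] (x y z : G) :
    ‖x - z‖ₑ ^ 2 ≤ 2 * ‖x - y‖ₑ ^ 2 + 2 * ‖y - z‖ₑ ^ 2 := by
  have h : ‖x - z‖ₑ ≤ ‖x - y‖ₑ + ‖y - z‖ₑ := by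
    rw [← sub_add_sub_cancel x y z]
    exact enorm_add_le _ _
  calc ‖x - z‖ₑ ^ 2 ≤ (‖x - y‖ₑ + ‖y - z‖ₑ) ^ 2 := by gcongr
    _ ≤ 2 * ‖x - y‖ₑ ^ 2 + 2 * ‖y - z‖ₑ ^ 2 := by
      have := ENNReal.rpow_add_le_mul_rpow_add_rpow ‖x - y‖ₑ ‖y - z‖ₑ (p := 2) (by norm_num)
      norm_num at this
      rwa [mul_add] at this

/-! ### Differences along segments -/

lemma norm_gradient {d : ℕ} (φ : E d → ℝ) (x : E d) : ‖gradient φ x‖ = ‖fderiv ℝ φ x‖ := by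
  rw [gradient, LinearIsometryEquiv.norm_map]

lemma continuous_gradient {d : ℕ} {φ : E d → ℝ} (hφ : ContDiff ℝ 1 φ) :
    Continuous (gradient φ) :=
  (LinearIsometryEquiv.continuous _).comp (hφ.continuous_fderiv one_ne_zero)

/-- The fundamental theorem of calculus along the segment, then Jensen's inequality on the unit
interval. -/
lemma enorm_sub_sq_le_segment {d : ℕ} {φ : E d → ℝ} (hφ : ContDiff ℝ 1 φ) (x y : E d) :
    ‖φ x - φ y‖ₑ ^ 2
      ≤ ‖x - y‖ₑ ^ 2 * ∫⁻ t in Ioc (0 : ℝ) 1, ‖gradient φ (y + t • (x - y))‖ₑ ^ 2 := by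
  have hprob : IsProbabilityMeasure ((volume : Measure ℝ).restrict (Ioc 0 1)) :=
    ⟨by simp⟩
  have hcont : Continuous fun t : ℝ => fderiv ℝ φ (y + t • (x - y)) (x - y) := by
    have := hφ.continuous_fderiv one_ne_zero
    fun_prop
  have hderiv : ∀ t : ℝ, HasDerivAt (fun t : ℝ => φ (y + t • (x - y)))
      (fderiv ℝ φ (y + t • (x - y)) (x - y)) t := by
    intro t
    have h1 : HasDerivAt (fun t : ℝ => y + t • (x - y)) (x - y) t := by
      simpa using ((hasDerivAt_id t).smul_const (x - y)).const_add y
    exact ((hφ.differentiable one_ne_zero).differentiableAt.hasFDerivAt).comp_hasDerivAt t h1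
  have hint := intervalIntegral.integral_eq_sub_of_hasDerivAt (a := 0) (b := 1)
    (fun t _ => hderiv t) (hcont.intervalIntegrable 0 1)
  rw [intervalIntegral.integral_of_le zero_le_one] at hint
  simp only [one_smul, add_sub_cancel, zero_smul, add_zero] at hint
  rw [← hint]
  refine (enorm_integral_sq_le hcont.aestronglyMeasurable).trans ?_
  rw [← lintegral_const_mul' _ _ (by simp)]
  refine lintegral_mono fun t => ?_
  rw [← mul_pow, mul_comm]
  gcongr
  rw [← enorm_norm (gradient φ _), norm_gradient, enorm_norm]
  exact ContinuousLinearMap.le_opENorm _ _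

section Segments

variable {d : ℕ} {f : E d → ENNReal}

/-- For fixed `t ≥ 1/2`, the map in `x` is a dilation with factor `t`; the bound is uniform in the
fixed endpoint `y`. -/
lemma lintegral_segment_end (hf : Measurable f) (y : E d) :
    ∫⁻ x, ∫⁻ t in Ioc (1 / 2 : ℝ) 1, f (y + t • (x - y)) ≤ 2 ^ d * ∫⁻ x, f x := by
  rw [lintegral_lintegral_swap (by fun_prop)]
  calc ∫⁻ t in Ioc (1 / 2 : ℝ) 1, ∫⁻ x, f (y + t • (x - y))
      ≤ ∫⁻ t in Ioc (1 / 2 : ℝ) 1, 2 ^ d * ∫⁻ x, f x := by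
        refine setLIntegral_mono' measurableSet_Ioc fun t ht => ?_
        have h := lintegral_comp_smul_add_le volume f ht.1.le (y - t • y)
        rw [finrank_euclideanSpace_fin] at h
        refine le_trans (le_of_eq ?_) h
        refine lintegral_congr fun x => ?_
        congr 1
        module
    _ ≤ 2 ^ d * ∫⁻ x, f x := by
        rw [setLIntegral_const, Real.volume_Ioc]
        refine mul_le_of_le_one_right' ?_
        rw [ENNReal.ofReal_le_one]
        norm_num

/-- The mirror image: here `y` is scaled by `1 - t ≥ 1/2`. -/
lemma lintegral_segment_start (hf : Measurable f) (x : E d) :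
    ∫⁻ y, ∫⁻ t in Ioc (0 : ℝ) (1 / 2), f (y + t • (x - y)) ≤ 2 ^ d * ∫⁻ x, f x := by
  rw [lintegral_lintegral_swap (by fun_prop)]
  calc ∫⁻ t in Ioc (0 : ℝ) (1 / 2), ∫⁻ y, f (y + t • (x - y))
      ≤ ∫⁻ t in Ioc (0 : ℝ) (1 / 2), 2 ^ d * ∫⁻ x, f x := by
        refine setLIntegral_mono' measurableSet_Ioc fun t ht => ?_
        have h := lintegral_comp_smul_add_le volume f
          (show 1 / 2 ≤ 1 - t by linarith [ht.2]) (t • x)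
        rw [finrank_euclideanSpace_fin] at h
        refine le_trans (le_of_eq ?_) h
        refine lintegral_congr fun x => ?_
        congr 1
        module
    _ ≤ 2 ^ d * ∫⁻ x, f x := by
        rw [setLIntegral_const, Real.volume_Ioc]
        refine mul_le_of_le_one_right' ?_
        rw [ENNReal.ofReal_le_one]
        norm_num

end Segments

/-- The segments from `a` to a hyperplane at distance at least `s` from `a`, in the half closer to
the hyperplane. -/
lemma lintegral_segment_hyperplane {m : ℕ} {f : E (m + 1) → ENNReal} (hf : Measurable f)
    (q : E (m + 1)) {n : E (m + 1)} (hn : ‖n‖ = 1) {a : E (m + 1)} {s : ℝ} (hs : 0 < s)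
    (ha : s ≤ |inner ℝ n (a - q)|) :
    ∫⁻ y : ↥(ℝ ∙ n)ᗮ, ∫⁻ t in Ioc (0 : ℝ) (1 / 2), f (y + q + t • (a - (y + q)))
      ≤ 2 ^ m * ENNReal.ofReal s⁻¹ * ∫⁻ x, f x := by
  set α : ℝ := inner ℝ n (a - q) with hα
  have hα0 : α ≠ 0 := by
    intro h
    rw [h] at ha
    simp at ha
    linarith
  have hW : a - q - α • n ∈ (ℝ ∙ n)ᗮ := by
    rw [Submodule.mem_orthogonal_singleton_iff_inner_right]
    simp [inner_sub_right, inner_smul_right, hn, hα]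
  set a' : ↥(ℝ ∙ n)ᗮ := ⟨a - q - α • n, hW⟩ with ha'
  have hmp := measurePreserving_flatMap q n hn
  set g : ℝ → ENNReal := fun τ => ∫⁻ y : ↥(ℝ ∙ n)ᗮ, f (flatMap q n (τ, y)) with hg
  have hfm : Measurable (fun p => f (flatMap q n p)) := hf.comp hmp.measurable
  have hgint : ∫⁻ τ, g τ = ∫⁻ x, f x := by
    rw [← hmp.lintegral_comp hf, Measure.volume_eq_prod, lintegral_prod _ hfm.aemeasurable]
  rw [lintegral_lintegral_swap (by fun_prop)]
  -- The point of the segment has height `α t` over the plane and in-plane part `(1 - t) y + t a'`.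
  -- Substituting in the plane costs `2 ^ m`, substituting the height costs `1 / |α| ≤ 1 / s`.
  calc ∫⁻ t in Ioc (0 : ℝ) (1 / 2), ∫⁻ y : ↥(ℝ ∙ n)ᗮ, f (y + q + t • (a - (y + q)))
      ≤ ∫⁻ t in Ioc (0 : ℝ) (1 / 2), 2 ^ m * g (α • t + 0) := by
        refine setLIntegral_mono' measurableSet_Ioc fun t ht => ?_
        have h := lintegral_comp_smul_add_le (volume : Measure ↥(ℝ ∙ n)ᗮ)
          (fun y => f (flatMap q n (α • t + 0, y)))
          (show 1 / 2 ≤ 1 - t by linarith [ht.2]) (t • a')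
        rw [finrank_orthogonal_span hn] at h
        refine le_trans (le_of_eq ?_) h
        refine lintegral_congr fun y => ?_
        congr 1
        simp only [flatMap, ha', Submodule.coe_add, Submodule.coe_smul, smul_eq_mul]
        module
    _ ≤ ∫⁻ t, 2 ^ m * g (α • t + 0) := setLIntegral_le_lintegral _ _
    _ = 2 ^ m * (ENNReal.ofReal |α⁻¹| * ∫⁻ x, f x) := by
        rw [lintegral_const_mul' _ _ (by simp), lintegral_comp_smul_add volume g hα0, hgint]
        simp
    _ ≤ 2 ^ m * ENNReal.ofReal s⁻¹ * ∫⁻ x, f x := by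
        rw [mul_assoc]
        gcongr
        rw [abs_inv]
        gcongr

/-- Squared differences of `φ` over a set `A` and a measure `ν`, in terms of its gradient. -/
lemma lintegral_enorm_sub_sq_le {d : ℕ} {φ : E d → ℝ} (hφ : ContDiff ℝ 1 φ) {K D A : Set (E d)}
    {R c : ENNReal} (hRt : R ≠ ⊤) (hKD : K ⊆ D) (hD : Convex ℝ D) (hDm : MeasurableSet D)
    (hR : ∀ x ∈ K, ∀ y ∈ K, ‖x - y‖ₑ ≤ R) (hA : MeasurableSet A) (hAK : A ⊆ K)
    (ν : Measure (E d)) [SFinite ν] (hν : ∀ᵐ y ∂ν, y ∈ K)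
    (hc : ∀ f : E d → ENNReal, Measurable f → ∀ a ∈ A,
      ∫⁻ y, (∫⁻ t in Ioc (0 : ℝ) (1 / 2), f (y + t • (a - y))) ∂ν ≤ c * ∫⁻ x, f x) :
    ∫⁻ a in A, ∫⁻ y, ‖φ a - φ y‖ₑ ^ 2 ∂ν
      ≤ R ^ 2 * ((c * volume A + 2 ^ d * ν univ) * ∫⁻ z in D, ‖gradient φ z‖ₑ ^ 2) := by
  have hgm : Measurable (gradient φ) := (continuous_gradient hφ).measurable
  -- Extension by zero allows changes of variables on the whole space; convexity of `D` keeps the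
  -- segments where nothing is lost.
  set f : E d → ENNReal := D.indicator fun z => ‖gradient φ z‖ₑ ^ 2 with hf
  have hfm : Measurable f := (hgm.enorm.pow_const 2).indicator hDm
  rw [← lintegral_indicator hDm, ← hf]
  have hpt : ∀ x ∈ K, ∀ y ∈ K, ‖φ x - φ y‖ₑ ^ 2
      ≤ R ^ 2 * ((∫⁻ t in Ioc (0 : ℝ) (1 / 2), f (y + t • (x - y)))
        + ∫⁻ t in Ioc (1 / 2 : ℝ) 1, f (y + t • (x - y))) := by
    intro x hx y hy
    rw [← lintegral_union measurableSet_Ioc (Ioc_disjoint_Ioc_of_le le_rfl),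
      Ioc_union_Ioc_eq_Ioc (by norm_num) (by norm_num)]
    refine (enorm_sub_sq_le_segment hφ x y).trans ?_
    gcongr ?_ ^ 2 * ?_
    · exact hR x hx y hy
    · refine setLIntegral_mono' measurableSet_Ioc fun t ht => ?_
      have hmem : y + t • (x - y) ∈ D := by
        have h := hD (hKD hy) (hKD hx) (show 0 ≤ 1 - t by linarith [ht.2]) ht.1.le (by ring)
        convert h using 1
        module
      rw [hf, indicator_of_mem hmem]
  calc ∫⁻ a in A, ∫⁻ y, ‖φ a - φ y‖ₑ ^ 2 ∂ν
      ≤ ∫⁻ a in A, ∫⁻ y, R ^ 2 * ((∫⁻ t in Ioc (0 : ℝ) (1 / 2), f (y + t • (a - y)))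
        + ∫⁻ t in Ioc (1 / 2 : ℝ) 1, f (y + t • (a - y))) ∂ν := by
        refine setLIntegral_mono' hA fun a ha => lintegral_mono_ae ?_
        filter_upwards [hν] with y hy using hpt a (hAK ha) y hy
    -- The half near `y` keeps `y` as inner variable, for `hc`; the half near `a` is swapped so that
    -- `a` is the inner one.
    _ = R ^ 2 * ((∫⁻ a in A, ∫⁻ y, (∫⁻ t in Ioc (0 : ℝ) (1 / 2), f (y + t • (a - y))) ∂ν)
        + ∫⁻ y, (∫⁻ a in A, ∫⁻ t in Ioc (1 / 2 : ℝ) 1, f (y + t • (a - y))) ∂ν) := by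
        have hm1 : Measurable fun p : E d × E d =>
            ∫⁻ t in Ioc (0 : ℝ) (1 / 2), f (p.2 + t • (p.1 - p.2)) :=
          Measurable.lintegral_prod_right' (f := fun p : (E d × E d) × ℝ =>
            f (p.1.2 + p.2 • (p.1.1 - p.1.2))) (by fun_prop)
        have hm2 : Measurable fun p : E d × E d =>
            ∫⁻ t in Ioc (1 / 2 : ℝ) 1, f (p.2 + t • (p.1 - p.2)) :=
          Measurable.lintegral_prod_right' (f := fun p : (E d × E d) × ℝ =>
            f (p.1.2 + p.2 • (p.1.1 - p.1.2))) (by fun_prop)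
        rw [lintegral_lintegral_swap (f := fun y a =>
          ∫⁻ t in Ioc (1 / 2 : ℝ) 1, f (y + t • (a - y))) (hm2.comp measurable_swap).aemeasurable,
          ← lintegral_add_left (Measurable.lintegral_prod_right' hm1)]
        rw [← lintegral_const_mul' _ _ (by finiteness)]
        refine lintegral_congr fun a => ?_
        have ha1 := hm1.comp (measurable_prodMk_left (x := a))
        rw [lintegral_const_mul' _ _ (by finiteness)]
        congr 1
        exact lintegral_add_left ha1 _
    _ ≤ R ^ 2 * ((∫⁻ a in A, c * ∫⁻ x, f x) + ∫⁻ y, (2 ^ d * ∫⁻ x, f x) ∂ν) := by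
        refine mul_le_mul_right (add_le_add ?_ (lintegral_mono fun y => ?_)) _
        · exact setLIntegral_mono' hA fun a ha => hc f hfm a ha
        · exact (setLIntegral_le_lintegral _ _).trans (lintegral_segment_end hfm y)
    _ = R ^ 2 * ((c * volume A + 2 ^ d * ν univ) * ∫⁻ z, f z) := by
        rw [setLIntegral_const, lintegral_const]
        ring

end Polytopal

/-! ### Polytopes and the inequality for smooth functions. -/

namespace Polytopal

/-! ### Geometry of polytopes -/

lemma IsPolytopalRegion.isCompact {d k : ℕ} {S : Set (E d)} (h : IsPolytopalRegion k S) :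
    IsCompact S := by
  obtain ⟨P, rfl⟩ := h.finite_union
  exact P.isCompact_biUnion fun s _ => s.finite_toSet.isCompact_convexHull ℝ

lemma IsPolytopalRegion.nonempty {d k : ℕ} {S : Set (E d)} (h : IsPolytopalRegion k S) :
    S.Nonempty :=
  h.connected.nonempty.mono intrinsicInterior_subset

lemma affineSpan_eq_top_of_finrank {d : ℕ} {S : Set (E d)} (h : IsPolytopalRegion d S) :
    affineSpan ℝ S = ⊤ := by
  have hne : (affineSpan ℝ S : Set (E d)).Nonempty := h.nonempty.affineSpan ℝ
  rw [← AffineSubspace.direction_eq_top_iff_of_nonempty hne]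
  apply Submodule.eq_top_of_finrank_eq
  rw [h.finrank_span, finrank_euclideanSpace_fin]

/-- In full dimension the affine span is everything, so the relative interior is open in the whole
space. -/
lemma IsPolytopalRegion.interior_nonempty {d : ℕ} {S : Set (E d)} (h : IsPolytopalRegion d S) :
    (interior S).Nonempty := by
  obtain ⟨x, hx⟩ := h.connected.nonempty
  rw [mem_intrinsicInterior] at hx
  obtain ⟨y, hy, rfl⟩ := hx
  have hopen : IsOpen (affineSpan ℝ S : Set (E d)) := by
    rw [affineSpan_eq_top_of_finrank h]
    exact isOpen_univ
  refine ⟨y, mem_interior.2 ⟨Subtype.val '' interior (Subtype.val ⁻¹' S), ?_, ?_, y, hy, rfl⟩⟩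
  · exact (image_mono interior_subset).trans (image_preimage_subset _ _)
  · exact hopen.isOpenMap_subtype_val _ isOpen_interior

/-- A region of codimension one lies in a hyperplane. -/
lemma IsPolytopalRegion.exists_hyperplane {m : ℕ} {F : Set (E (m + 1))}
    (h : IsPolytopalRegion m F) : ∃ q n : E (m + 1), ‖n‖ = 1 ∧
      F ⊆ range fun y : ↥(ℝ ∙ n)ᗮ => (y : E (m + 1)) + q := by
  obtain ⟨q, hq⟩ := h.nonempty
  have hne : (affineSpan ℝ F).directionᗮ ≠ ⊥ := by
    intro h0
    have := (affineSpan ℝ F).direction.finrank_add_finrank_orthogonal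
    rw [h0, h.finrank_span, finrank_bot, finrank_euclideanSpace_fin] at this
    omega
  obtain ⟨v, hv, hv0⟩ := Submodule.exists_mem_ne_zero_of_ne_bot hne
  refine ⟨q, (‖v‖⁻¹ : ℝ) • v, norm_smul_inv_norm hv0, fun x hx => ?_⟩
  refine ⟨⟨x - q, ?_⟩, sub_add_cancel x q⟩
  rw [Submodule.mem_orthogonal_singleton_iff_inner_right, inner_smul_left]
  have hmem : x - q ∈ (affineSpan ℝ F).direction :=
    AffineSubspace.vsub_mem_direction (subset_affineSpan ℝ F hx) (subset_affineSpan ℝ F hq)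
  rw [Submodule.inner_left_of_mem_orthogonal hmem hv, mul_zero]

lemma exists_norm_eq_one (m : ℕ) : ∃ n : E (m + 1), ‖n‖ = 1 :=
  ⟨EuclideanSpace.single 0 1, by simp⟩

lemma surfaceMeasure_lt_top {m : ℕ} {F : Set (E (m + 1))} (hF : IsCompact F) {q n : E (m + 1)}
    (hn : ‖n‖ = 1) (hsub : F ⊆ range fun y : ↥(ℝ ∙ n)ᗮ => (y : E (m + 1)) + q) :
    surfaceMeasure (m + 1) F < ⊤ := by
  have h := setLIntegral_surfaceMeasure hn hF.measurableSet hsub 1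
  simp only [Pi.one_apply, lintegral_one, Measure.restrict_apply_univ] at h
  rw [h]
  exact ((isometry_vadd_subspace q (ℝ ∙ n)ᗮ).isClosedEmbedding.isCompact_preimage hF).measure_lt_top

/-- A compact set of positive volume has a boundary of positive surface measure. -/
lemma surfaceMeasure_frontier_ne_zero {m : ℕ} {K : Set (E (m + 1))} (hK : IsCompact K)
    (hK0 : volume K ≠ 0) : surfaceMeasure (m + 1) (frontier K) ≠ 0 := by
  intro h0
  obtain ⟨n, hn⟩ := exists_norm_eq_one m
  obtain ⟨R, hR⟩ := hK.isBounded.exists_norm_le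
  -- A slab this wide contains all of `K`, so `|K|` is bounded by a multiple of `|∂K|`.
  have h := volume_slab_le hK 0 hn (R + 1)
  rw [h0, mul_zero, nonpos_iff_eq_zero, inter_eq_self_of_subset_left] at h
  · exact hK0 h
  · intro x hx
    have := abs_real_inner_le_norm n x
    rw [hn, one_mul] at this
    simp only [sub_zero, mem_ofPred_eq]
    linarith [hR x hx]

section Polytope

variable {m : ℕ} (K : Polytope (m + 1))

lemma Polytope.isCompact : IsCompact K.carrier := K.region.isCompact

lemma Polytope.volume_ne_zero : volume K.carrier ≠ 0 := by
  have h := isOpen_interior.measure_pos volume K.region.interior_nonempty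
  exact (h.trans_le (measure_mono interior_subset)).ne'

lemma Polytope.surfaceMeasure_frontier_lt_top :
    surfaceMeasure (m + 1) (frontier K.carrier) < ⊤ := by
  rw [← K.iUnion_faces]
  refine (measure_biUnion_finset_le _ _).trans_lt (ENNReal.sum_lt_top.2 fun F hF => ?_)
  obtain ⟨q, n, hn, hsub⟩ := (K.face_region F hF).exists_hyperplane
  exact surfaceMeasure_lt_top (K.face_region F hF).isCompact hn hsub

instance : IsFiniteMeasure (boundaryMeasure K) :=
  ⟨by simpa [boundaryMeasure] using K.surfaceMeasure_frontier_lt_top⟩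

lemma boundaryMeasure_univ :
    boundaryMeasure K univ = surfaceMeasure (m + 1) (frontier K.carrier) := by
  simp [boundaryMeasure]

instance : NeZero (boundaryMeasure K) :=
  ⟨by
    rw [← Measure.measure_univ_ne_zero, boundaryMeasure_univ]
    exact surfaceMeasure_frontier_ne_zero K.isCompact K.volume_ne_zero⟩

/-- Subadditivity over the faces suffices, so their intersections need not be shown to be null. -/
lemma lintegral_boundaryMeasure_le (f : E (m + 1) → ENNReal) :
    ∫⁻ x, f x ∂boundaryMeasure K
      ≤ ∑ F ∈ K.faces, ∫⁻ x in F, f x ∂surfaceMeasure (m + 1) := by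
  rw [boundaryMeasure, ← K.iUnion_faces, ← Finset.set_biUnion_coe, biUnion_eq_iUnion]
  refine (lintegral_mono' Measure.restrict_iUnion_le le_rfl).trans ?_
  rw [lintegral_sum_measure, tsum_fintype]
  exact (Finset.sum_coe_sort K.faces fun F => ∫⁻ x in F, f x ∂surfaceMeasure (m + 1)).le

/-- The frontier of a convex set is null. The segment estimate needs a convex set that contains
`∂K`, which the open hull does not. -/
lemma restrict_closure_convexHull :
    volume.restrict (closure (convexHull ℝ K.carrier)) = volume.restrict (hull K) := by
  have h0 := (convex_convexHull ℝ K.carrier).addHaar_frontier volume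
  exact Measure.restrict_congr_set
    ((closure_ae_eq_of_null_frontier h0).trans (interior_ae_eq_of_null_frontier h0).symm)

lemma restrict_carrier_le : volume.restrict K.carrier ≤ volume.restrict (hull K) := by
  rw [← restrict_closure_convexHull]
  exact Measure.restrict_mono ((subset_convexHull ℝ _).trans subset_closure) le_rfl

end Polytope

/-! ### The Poincaré inequality for smooth functions -/

/-- Triangle inequality for mean squared differences, through an intermediate measure `ρ`. -/
lemma lintegral_sub_sq_triangle {α : Type*} [MeasurableSpace α] {φ : α → ℝ} (hφ : Measurable φ)
    (μ ν ρ : Measure α) [SFinite μ] [SFinite ν] [SFinite ρ] :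
    ρ univ * ∫⁻ x, ∫⁻ y, ‖φ x - φ y‖ₑ ^ 2 ∂ν ∂μ
      ≤ 2 * ν univ * ∫⁻ x, ∫⁻ a, ‖φ x - φ a‖ₑ ^ 2 ∂ρ ∂μ
        + 2 * μ univ * ∫⁻ a, ∫⁻ y, ‖φ a - φ y‖ₑ ^ 2 ∂ν ∂ρ := by
  have hQ : Measurable fun p : α × α => ‖φ p.1 - φ p.2‖ₑ ^ 2 := by fun_prop
  have hQ1 : ∀ x, Measurable fun y => ‖φ x - φ y‖ₑ ^ 2 := fun x => by fun_prop
  have hQ2 : ∀ y, Measurable fun x => ‖φ x - φ y‖ₑ ^ 2 := fun x => by fun_prop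
  have h1 : ∀ x y, ρ univ * ‖φ x - φ y‖ₑ ^ 2
      ≤ 2 * (∫⁻ a, ‖φ x - φ a‖ₑ ^ 2 ∂ρ) + 2 * ∫⁻ a, ‖φ a - φ y‖ₑ ^ 2 ∂ρ := by
    intro x y
    rw [mul_comm, ← lintegral_const, ← lintegral_const_mul _ (hQ1 x),
      ← lintegral_const_mul _ (hQ2 y), ← lintegral_add_left (by fun_prop)]
    exact lintegral_mono fun a => enorm_sub_sq_le _ _ _
  have hm1 : Measurable fun x => ∫⁻ y, ‖φ x - φ y‖ₑ ^ 2 ∂ν := Measurable.lintegral_prod_right' hQ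
  have hm2 : Measurable fun y => ∫⁻ a, ‖φ a - φ y‖ₑ ^ 2 ∂ρ := Measurable.lintegral_prod_left' hQ
  have hm3 : Measurable fun x => ∫⁻ a, ‖φ x - φ a‖ₑ ^ 2 ∂ρ := Measurable.lintegral_prod_right' hQ
  calc ρ univ * ∫⁻ x, ∫⁻ y, ‖φ x - φ y‖ₑ ^ 2 ∂ν ∂μ
      = ∫⁻ x, ∫⁻ y, ρ univ * ‖φ x - φ y‖ₑ ^ 2 ∂ν ∂μ := by
        rw [← lintegral_const_mul _ hm1]
        exact lintegral_congr fun x => (lintegral_const_mul _ (hQ1 x)).symm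
    _ ≤ ∫⁻ x, ∫⁻ y, (2 * (∫⁻ a, ‖φ x - φ a‖ₑ ^ 2 ∂ρ) + 2 * ∫⁻ a, ‖φ a - φ y‖ₑ ^ 2 ∂ρ) ∂ν ∂μ :=
        lintegral_mono fun x => lintegral_mono fun y => h1 x y
    _ = ∫⁻ x, (2 * ν univ * (∫⁻ a, ‖φ x - φ a‖ₑ ^ 2 ∂ρ)
          + 2 * ∫⁻ y, ∫⁻ a, ‖φ a - φ y‖ₑ ^ 2 ∂ρ ∂ν) ∂μ := by
        refine lintegral_congr fun x => ?_
        rw [lintegral_add_left measurable_const, lintegral_const, lintegral_const_mul _ hm2]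
        ring
    _ = 2 * ν univ * (∫⁻ x, ∫⁻ a, ‖φ x - φ a‖ₑ ^ 2 ∂ρ ∂μ)
          + 2 * μ univ * ∫⁻ y, ∫⁻ a, ‖φ a - φ y‖ₑ ^ 2 ∂ρ ∂ν := by
        rw [lintegral_add_left (hm3.const_mul _), lintegral_const, lintegral_const_mul _ hm3]
        ring
    _ = _ := by
        rw [lintegral_lintegral_swap (f := fun y a => ‖φ a - φ y‖ₑ ^ 2)
          (hQ.comp measurable_swap).aemeasurable]

/-- Mean squared differences between a compact set `K` and a flat part `F` of its boundary. -/
lemma lintegral_sub_sq_face_le {m : ℕ} {φ : E (m + 1) → ℝ} (hφ : ContDiff ℝ 1 φ)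
    {K D F : Set (E (m + 1))} {R : ENNReal} (hRt : R ≠ ⊤) (hKD : K ⊆ D) (hD : Convex ℝ D)
    (hDm : MeasurableSet D) (hR : ∀ x ∈ K, ∀ y ∈ K, ‖x - y‖ₑ ≤ R) (hK : IsCompact K)
    (hK0 : volume K ≠ 0) (hb : surfaceMeasure (m + 1) (frontier K) ≠ ⊤) (hF : MeasurableSet F)
    (hFK : F ⊆ frontier K) {q n : E (m + 1)} (hn : ‖n‖ = 1)
    (hsub : F ⊆ range fun y : ↥(ℝ ∙ n)ᗮ => (y : E (m + 1)) + q) :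
    ∫⁻ x in K, ∫⁻ y in F, ‖φ x - φ y‖ₑ ^ 2 ∂surfaceMeasure (m + 1)
      ≤ 28 * 2 ^ (m + 1) * surfaceMeasure (m + 1) (frontier K)
        * (R ^ 2 * ∫⁻ z in D, ‖gradient φ z‖ₑ ^ 2) := by
  set I := ∫⁻ z in D, ‖gradient φ z‖ₑ ^ 2
  set b := surfaceMeasure (m + 1) (frontier K)
  set k := volume K with hk
  have hb0 : b ≠ 0 := surfaceMeasure_frontier_ne_zero hK hK0
  have hkt : k ≠ ⊤ := hK.measure_lt_top.ne
  have hFb : surfaceMeasure (m + 1) F ≤ b := measure_mono hFK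
  have hFK' : F ⊆ K := hFK.trans hK.isClosed.frontier_subset
  have hkb0 : k / (4 * b) ≠ 0 := ENNReal.div_ne_zero.2 ⟨hK0, by finiteness⟩
  have hkbt : k / (4 * b) ≠ ⊤ := ENNReal.div_ne_top hkt (by simp [hb0])
  -- Chosen so that the slab bound `2 s b` equals `k / 2`.
  set s : ℝ := (k / (4 * b)).toReal
  have hs : 0 < s := ENNReal.toReal_pos hkb0 hkbt
  have hsE : ENNReal.ofReal s = k / (4 * b) := ENNReal.ofReal_toReal hkbt
  set A := K ∩ {x | s ≤ |inner ℝ n (x - q)|} with hA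
  have hAm : MeasurableSet A :=
    hK.measurableSet.inter (isClosed_le continuous_const (by fun_prop)).measurableSet
  have hAk : volume A ≤ k := measure_mono inter_subset_left
  have hkA : k / 2 ≤ volume A := by
    have h1 := volume_slab_le hK q hn s
    have h2 : ENNReal.ofReal (2 * s) * b = k / 2 := by
      rw [ENNReal.ofReal_mul zero_le_two, hsE]
      have : (4 : ENNReal) * b = 2 * (2 * b) := by ring
      rw [ENNReal.ofReal_ofNat, this, ← mul_div_assoc,
        ENNReal.mul_div_mul_left _ _ (by simp) (by simp), mul_comm, ← mul_div_assoc,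
        mul_comm 2 b, ENNReal.mul_div_mul_left _ _ hb0 hb]
    have h3 : k ≤ volume A + k / 2 := by
      calc k ≤ volume (A ∪ (K ∩ {x | |inner ℝ n (x - q)| < s})) := by
            refine measure_mono fun x hx => ?_
            rcases le_or_gt s |inner ℝ n (x - q)| with h | h
            · exact Or.inl ⟨hx, h⟩
            · exact Or.inr ⟨hx, h⟩
        _ ≤ volume A + k / 2 := (measure_union_le _ _).trans (by rw [← h2]; gcongr)
    have h4 : k / 2 ≠ ⊤ := ENNReal.div_ne_top hkt (by simp)
    rw [← ENNReal.add_halves k] at h3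
    exact (ENNReal.add_le_add_iff_right (by simpa using h4)).1 (by simpa using h3)
  have hfin : SFinite ((surfaceMeasure (m + 1)).restrict F) := by
    have : IsFiniteMeasure ((surfaceMeasure (m + 1)).restrict F) :=
      ⟨by simpa using hFb.trans_lt hb.lt_top⟩
    infer_instance
  -- From `K` to `A` both ends range over solid sets and both halves cost `2 ^ (m + 1)`; from `A` to
  -- `F` the half near `F` costs `2 ^ m / s`.
  have hVV := lintegral_enorm_sub_sq_le hφ hRt hKD hD hDm hR hK.measurableSet subset_rfl
    (volume.restrict A) ((ae_restrict_mem hAm).mono fun x hx => hx.1) (c := 2 ^ (m + 1))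
    (fun f hf a _ => (setLIntegral_le_lintegral _ _).trans (lintegral_segment_start hf a))
  have hVF := lintegral_enorm_sub_sq_le hφ hRt hKD hD hDm hR hAm inter_subset_left
    ((surfaceMeasure (m + 1)).restrict F) ((ae_restrict_mem hF).mono fun x hx => hFK' hx)
    (c := 2 ^ m * ENNReal.ofReal s⁻¹) (fun f hf a ha => by
      rw [setLIntegral_surfaceMeasure hn hF hsub]
      exact (setLIntegral_le_lintegral _ _).trans (lintegral_segment_hyperplane hf q hn hs ha.2))
  have htri := lintegral_sub_sq_triangle hφ.continuous.measurable (volume.restrict K)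
    ((surfaceMeasure (m + 1)).restrict F) (volume.restrict A)
  simp only [Measure.restrict_apply_univ, ← hk] at hVV hVF htri
  -- Since `1 / s = 4 b / k` and `|A| ≤ k`, the volume cancels. The surplus factor `2` only makes
  -- the powers of two agree.
  have hcA : 2 ^ m * ENNReal.ofReal s⁻¹ * volume A ≤ 2 ^ (m + 1) * (4 * b) := by
    rw [ENNReal.ofReal_inv_of_pos hs, hsE, ENNReal.inv_div (Or.inr hkt) (Or.inr hK0)]
    calc 2 ^ m * (4 * b / k) * volume A ≤ 2 ^ (m + 1) * (4 * b / k) * k := by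
          gcongr
          · norm_num
          · omega
      _ = 2 ^ (m + 1) * (4 * b) := by rw [mul_assoc, ENNReal.div_mul_cancel hK0 hkt]
  -- The two parts contribute `2 * (1 + 1)` and `2 * (4 + 1)`, in all `14`; dividing by `k / 2`
  -- instead of `k` makes it `28`.
  have hfinal : k / 2 * ∫⁻ x in K, ∫⁻ y in F, ‖φ x - φ y‖ₑ ^ 2 ∂surfaceMeasure (m + 1)
      ≤ k / 2 * (28 * 2 ^ (m + 1) * b * (R ^ 2 * I)) := by
    calc k / 2 * ∫⁻ x in K, ∫⁻ y in F, ‖φ x - φ y‖ₑ ^ 2 ∂surfaceMeasure (m + 1)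
        ≤ 2 * b * (R ^ 2 * ((2 ^ (m + 1) * k + 2 ^ (m + 1) * k) * I))
          + 2 * k * (R ^ 2 * ((2 ^ (m + 1) * (4 * b) + 2 ^ (m + 1) * b) * I)) := by
          refine (mul_le_mul_left hkA _).trans (htri.trans ?_)
          refine add_le_add (mul_le_mul' (by gcongr) ?_) (mul_le_mul' le_rfl ?_)
          · refine hVV.trans ?_
            gcongr
          · refine hVF.trans ?_
            gcongr
      _ = k * (14 * 2 ^ (m + 1) * b * (R ^ 2 * I)) := by ring
      _ = k / 2 * (28 * 2 ^ (m + 1) * b * (R ^ 2 * I)) := by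
          have : (28 : ENNReal) = 2 * 14 := by norm_num
          rw [this, mul_assoc 2, mul_assoc 2, mul_assoc 2, ← mul_assoc (k / 2),
            ENNReal.div_mul_cancel (by simp) (by simp)]
  exact (ENNReal.mul_le_mul_iff_right (ENNReal.div_ne_zero.2 ⟨hK0, by simp⟩)
    (ENNReal.div_ne_top hkt (by simp))).1 hfinal

/-- Mean squared differences between a polytope and its boundary. -/
lemma lintegral_sub_sq_boundary_le {m : ℕ} (K : Polytope (m + 1)) {φ : E (m + 1) → ℝ}
    (hφ : ContDiff ℝ 1 φ) :
    ∫⁻ y, ∫⁻ x in K.carrier, ‖φ x - φ y‖ₑ ^ 2 ∂volume ∂boundaryMeasure K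
      ≤ K.faces.card * (28 * 2 ^ (m + 1) * boundaryMeasure K univ
        * (ENNReal.ofReal (Metric.diam K.carrier) ^ 2
          * ∫⁻ z in hull K, ‖gradient φ z‖ₑ ^ 2)) := by
  refine (lintegral_boundaryMeasure_le K _).trans ?_
  rw [← nsmul_eq_mul]
  refine Finset.sum_le_card_nsmul _ _ _ fun F hF => ?_
  obtain ⟨q, n, hn, hsub⟩ := (K.face_region F hF).exists_hyperplane
  have hFm : MeasurableSet F := (K.face_region F hF).isCompact.measurableSet
  have hFK : F ⊆ frontier K.carrier := by
    rw [← K.iUnion_faces]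
    exact subset_biUnion_of_mem (u := fun F => F) hF
  have hfin : IsFiniteMeasure ((surfaceMeasure (m + 1)).restrict F) :=
    ⟨by simpa using (measure_mono hFK).trans_lt K.surfaceMeasure_frontier_lt_top⟩
  have hφm := hφ.continuous.measurable
  rw [lintegral_lintegral_swap (by fun_prop), boundaryMeasure_univ, ← restrict_closure_convexHull]
  refine lintegral_sub_sq_face_le hφ (by finiteness)
    ((subset_convexHull ℝ K.carrier).trans subset_closure) (convex_convexHull ℝ _).closure
    isClosed_closure.measurableSet ?_
    K.isCompact K.volume_ne_zero K.surfaceMeasure_frontier_lt_top.ne hFm hFK hn hsub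
  · intro x hx y hy
    rw [← ofReal_norm, ← dist_eq_norm]
    exact ENNReal.ofReal_le_ofReal (Metric.dist_le_diam_of_mem K.isCompact.isBounded hx hy)

lemma memLp_boundaryMeasure {m : ℕ} (K : Polytope (m + 1)) {φ : E (m + 1) → ℝ}
    (hφ : Continuous φ) : MemLp φ 2 (boundaryMeasure K) := by
  obtain ⟨C, hC⟩ := K.isCompact.exists_bound_of_continuousOn hφ.continuousOn
  refine MemLp.of_bound hφ.aestronglyMeasurable C ?_
  filter_upwards [ae_restrict_mem isClosed_frontier.measurableSet] with x hx
  exact hC x (K.isCompact.isClosed.frontier_subset hx)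

/-- The deviation from the boundary average is the average of `φ x - φ y` over `y ∈ ∂K`. After
Jensen's inequality the factor `1 / |∂K|` cancels the one in the double integral bound. -/
lemma lintegral_sub_average_sq_le {m : ℕ} (K : Polytope (m + 1)) {φ : E (m + 1) → ℝ}
    (hφ : ContDiff ℝ 1 φ) :
    ∫⁻ x in K.carrier, ‖φ x - ⨍ y, φ y ∂boundaryMeasure K‖ₑ ^ 2
      ≤ K.faces.card * (28 * 2 ^ (m + 1)) * (ENNReal.ofReal (Metric.diam K.carrier) ^ 2
          * ∫⁻ z in hull K, ‖gradient φ z‖ₑ ^ 2) := by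
  have hφm := hφ.continuous.measurable
  set β := boundaryMeasure K
  have hβ0 : β univ ≠ 0 := Measure.measure_univ_ne_zero.2 (NeZero.ne _)
  have hβt : β univ ≠ ⊤ := measure_ne_top _ _
  have hJ : ∀ x, ‖φ x - ⨍ y, φ y ∂β‖ₑ ^ 2 ≤ (β univ)⁻¹ * ∫⁻ y, ‖φ x - φ y‖ₑ ^ 2 ∂β := by
    intro x
    have hint : Integrable φ ((β univ)⁻¹ • β) :=
      ((memLp_boundaryMeasure K hφ.continuous).integrable (by norm_num)).smul_measure (ENNReal.inv_ne_top.2 hβ0)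
    have h1 : φ x - ⨍ y, φ y ∂β = ∫ y, (φ x - φ y) ∂(β univ)⁻¹ • β := by
      rw [integral_sub (integrable_const _) hint, integral_const, average]
      simp
    rw [h1, ← smul_eq_mul, ← lintegral_smul_measure]
    exact enorm_integral_sq_le (by fun_prop)
  calc ∫⁻ x in K.carrier, ‖φ x - ⨍ y, φ y ∂β‖ₑ ^ 2
      ≤ ∫⁻ x in K.carrier, (β univ)⁻¹ * ∫⁻ y, ‖φ x - φ y‖ₑ ^ 2 ∂β := lintegral_mono hJ
    _ = (β univ)⁻¹ * ∫⁻ y, ∫⁻ x in K.carrier, ‖φ x - φ y‖ₑ ^ 2 ∂volume ∂β := by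
        rw [lintegral_const_mul' _ _ (ENNReal.inv_ne_top.2 hβ0), lintegral_lintegral_swap (by fun_prop)]
    _ ≤ (β univ)⁻¹ * (K.faces.card * (28 * 2 ^ (m + 1) * β univ
        * (ENNReal.ofReal (Metric.diam K.carrier) ^ 2
          * ∫⁻ z in hull K, ‖gradient φ z‖ₑ ^ 2))) := by
        gcongr
        exact lintegral_sub_sq_boundary_le K hφ
    _ = ((β univ)⁻¹ * β univ) * (K.faces.card * (28 * 2 ^ (m + 1))
        * (ENNReal.ofReal (Metric.diam K.carrier) ^ 2
          * ∫⁻ z in hull K, ‖gradient φ z‖ₑ ^ 2)) := by ring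
    _ = _ := by rw [ENNReal.inv_mul_cancel hβ0 hβt, one_mul]

end Polytopal

/-! ### Affine changes of variables and mollification in `L²`. -/

namespace Polytopal

/-! ### Continuity of affine changes of variables in `L²` -/

lemma eLpNorm_two_le_iff {α G : Type*} [MeasurableSpace α] [NormedAddCommGroup G]
    {μ : Measure α} {f : α → G} {c : ENNReal} :
    eLpNorm f 2 μ ≤ c ↔ ∫⁻ x, ‖f x‖ₑ ^ 2 ∂μ ≤ c ^ 2 := by
  rw [← eLpNorm_two_sq]
  exact (ENNReal.pow_le_pow_left_iff two_ne_zero).symm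

lemma tendsto_eLpNorm_two_zero {α G ι : Type*} [MeasurableSpace α] [NormedAddCommGroup G]
    {μ : Measure α} {l : Filter ι} {f : ι → α → G}
    (h : Tendsto (fun i => ∫⁻ x, ‖f i x‖ₑ ^ 2 ∂μ) l (𝓝 0)) :
    Tendsto (fun i => eLpNorm (f i) 2 μ) l (𝓝 0) := by
  rw [ENNReal.tendsto_nhds_zero] at h ⊢
  intro ε hε
  filter_upwards [h (ε ^ 2) (ENNReal.pow_pos hε 2)] with i hi
  exact eLpNorm_two_le_iff.2 hi

section Dilation

variable {d : ℕ} {G : Type*} [NormedAddCommGroup G]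

lemma eventually_nhds_one_zero : ∀ᶠ p : ℝ × E d in 𝓝 (1, 0), 1 / 2 ≤ p.1 ∧ ‖p.2‖ ≤ 1 := by
  have h1 : ∀ᶠ p : ℝ × E d in 𝓝 (1, 0), 1 / 2 < p.1 :=
    continuous_fst.continuousAt.eventually (lt_mem_nhds (by norm_num))
  have h2 : ∀ᶠ p : ℝ × E d in 𝓝 (1, 0), ‖p.2‖ < 1 :=
    continuous_snd.norm.continuousAt.eventually (gt_mem_nhds (by simp))
  filter_upwards [h1, h2] with p hp1 hp2 using ⟨hp1.le, hp2.le⟩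

/-- Dominated convergence: for parameters near `(1, 0)` the differences are bounded by `2 C` and
vanish outside one fixed ball. -/
lemma tendsto_eLpNorm_comp_smul_add_of_hasCompactSupport {k : E d → G} (hk : Continuous k)
    (hc : HasCompactSupport k) :
    Tendsto (fun p : ℝ × E d => eLpNorm (fun x => k (p.1 • x + p.2) - k x) 2 volume)
      (𝓝 (1, 0)) (𝓝 0) := by
  obtain ⟨C, hC⟩ := hc.exists_bound_of_continuous hk
  obtain ⟨R, hR⟩ := hc.isCompact.isBounded.exists_norm_le
  have hzero : ∀ x, |R| < ‖x‖ → k x = 0 := by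
    intro x hx
    by_contra h
    have := hR x (subset_tsupport k h)
    linarith [le_abs_self R]
  apply tendsto_eLpNorm_two_zero
  have hlim := tendsto_lintegral_filter_of_dominated_convergence (μ := (volume : Measure (E d)))
    (l := 𝓝 ((1 : ℝ), (0 : E d))) (F := fun p x => ‖k (p.1 • x + p.2) - k x‖ₑ ^ 2)
    (f := fun _ => 0)
    ((Metric.closedBall 0 (2 * (|R| + 1))).indicator fun _ => ENNReal.ofReal (C + C) ^ 2)
    (Eventually.of_forall fun p => Continuous.measurable (by fun_prop)) ?_ ?_ ?_
  · simpa using hlim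
  · filter_upwards [eventually_nhds_one_zero] with p hp
    refine Eventually.of_forall fun x => ?_
    by_cases hx : x ∈ Metric.closedBall 0 (2 * (|R| + 1))
    · rw [indicator_of_mem hx, ← ofReal_norm]
      gcongr
      exact (norm_sub_le _ _).trans (add_le_add (hC _) (hC _))
    · rw [indicator_of_notMem hx]
      rw [mem_closedBall_zero_iff, not_le] at hx
      have h1 : k x = 0 := hzero x (by linarith [abs_nonneg R])
      have h2 : k (p.1 • x + p.2) = 0 := by
        apply hzero
        have h3 : ‖p.1 • x‖ ≤ ‖p.1 • x + p.2‖ + ‖p.2‖ := by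
          simpa using norm_sub_le (p.1 • x + p.2) p.2
        rw [norm_smul, Real.norm_of_nonneg (by linarith [hp.1])] at h3
        nlinarith [hp.1, hp.2, abs_nonneg R]
      simp [h1, h2]
  · rw [lintegral_indicator_const Metric.isClosed_closedBall.measurableSet]
    exact ENNReal.mul_ne_top (by finiteness) measure_closedBall_lt_top.ne
  · refine Eventually.of_forall fun x => ?_
    have hcont : Continuous fun p : ℝ × E d => ‖k (p.1 • x + p.2) - k x‖ₑ ^ 2 := by fun_prop
    simpa using hcont.tendsto (1, 0)

lemma eLpNorm_comp_smul_add_le (f : E d → G) {r : ℝ} (hr : 1 / 2 ≤ r) (b : E d) :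
    eLpNorm (fun x => f (r • x + b)) 2 volume ≤ 2 ^ d * eLpNorm f 2 volume := by
  rw [eLpNorm_two_le_iff, mul_pow, eLpNorm_two_sq]
  refine (lintegral_comp_smul_add_le volume (fun x => ‖f x‖ₑ ^ 2) hr b).trans ?_
  rw [finrank_euclideanSpace_fin]
  exact mul_le_mul' (le_self_pow₀ (one_le_pow₀ (by norm_num)) two_ne_zero) le_rfl

lemma quasiMeasurePreserving_smul_add {r : ℝ} (hr : r ≠ 0) (b : E d) :
    Measure.QuasiMeasurePreserving (fun x : E d => r • x + b) volume volume := by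
  refine ⟨by fun_prop, fun s hs => ?_⟩
  obtain ⟨t, hst, ht, ht0⟩ := exists_measurable_superset_of_null hs
  refine measure_mono_null hst ?_
  rw [Measure.map_apply (by fun_prop) ht]
  have h := lintegral_comp_smul_add volume (t.indicator 1) hr b
  rw [lintegral_indicator_one ht, ht0, mul_zero] at h
  rw [← lintegral_indicator_one (ht.preimage (by fun_prop))]
  exact h

/-- Affine changes of variables act continuously in `L²`. -/
lemma tendsto_eLpNorm_comp_smul_add [NormedSpace ℝ G] {f : E d → G} (hf : MemLp f 2 volume) :
    Tendsto (fun p : ℝ × E d => eLpNorm (fun x => f (p.1 • x + p.2) - f x) 2 volume)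
      (𝓝 (1, 0)) (𝓝 0) := by
  rw [ENNReal.tendsto_nhds_zero]
  intro ε hε
  -- The error is split into `f - k` after the change of variables (factor `2 ^ d`), the difference
  -- for `k`, and `f - k` itself.
  set c : ENNReal := 2 ^ d + 2
  have hc : ε / c ≠ 0 := ENNReal.div_ne_zero.2 ⟨hε.ne', by finiteness⟩
  obtain ⟨k, hkc, hfk, hk, hkL⟩ := hf.exists_hasCompactSupport_eLpNorm_sub_le (by simp) hc
  filter_upwards [eventually_nhds_one_zero,
    ENNReal.tendsto_nhds_zero.1 (tendsto_eLpNorm_comp_smul_add_of_hasCompactSupport hk hkc)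
      (ε / c) (pos_iff_ne_zero.2 hc)] with p hp hpk
  have hq := quasiMeasurePreserving_smul_add (show p.1 ≠ 0 by linarith [hp.1]) p.2
  have hm := hf.1.sub hkL.1
  have hm1 : AEStronglyMeasurable (fun x => (f - k) (p.1 • x + p.2)) volume :=
    hm.comp_quasiMeasurePreserving hq
  have hm2 : AEStronglyMeasurable (fun x => k (p.1 • x + p.2) - k x) volume :=
    Continuous.aestronglyMeasurable (by fun_prop)
  have hsplit : (fun x => f (p.1 • x + p.2) - f x)
      = (fun x => (f - k) (p.1 • x + p.2)) + (fun x => k (p.1 • x + p.2) - k x) - (f - k) := by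
    ext x
    simp
  calc eLpNorm (fun x => f (p.1 • x + p.2) - f x) 2 volume
      ≤ eLpNorm (fun x => (f - k) (p.1 • x + p.2)) 2 volume
        + eLpNorm (fun x => k (p.1 • x + p.2) - k x) 2 volume + eLpNorm (f - k) 2 volume := by
        rw [hsplit]
        refine (eLpNorm_sub_le (hm1.add hm2) hm (by norm_num)).trans ?_
        gcongr
        exact eLpNorm_add_le hm1 hm2 (by norm_num)
    _ ≤ 2 ^ d * (ε / c) + ε / c + ε / c := by
        gcongr
        exact (eLpNorm_comp_smul_add_le _ hp.1 _).trans (by gcongr)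
    _ = c * (ε / c) := by ring
    _ ≤ ε := ENNReal.mul_div_le

end Dilation

/-! ### Mollification -/

section Mollify

variable {d : ℕ} {G : Type*} [NormedAddCommGroup G] [NormedSpace ℝ G]

/-- The convolution of `f` with a normalised bump function. -/
noncomputable def mollify (ρ : ContDiffBump (0 : E d)) (f : E d → G) (p : E d) : G :=
  ∫ t, ρ.normed volume (p - t) • f t

lemma mollify_eq_convolution (ρ : ContDiffBump (0 : E d)) (f : E d → ℝ) :
    mollify ρ f = convolution f (ρ.normed volume) (ContinuousLinearMap.lsmul ℝ ℝ) volume := by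
  ext p
  simp [mollify, convolution, mul_comm]

lemma contDiff_mollify (ρ : ContDiffBump (0 : E d)) {f : E d → ℝ}
    (hf : LocallyIntegrable f volume) :
    ContDiff ℝ ((⊤ : ℕ∞) : WithTop ℕ∞) (mollify ρ f) := by
  rw [mollify_eq_convolution]
  exact ρ.hasCompactSupport_normed.contDiff_convolution_right _ hf ρ.contDiff_normed

/-- The probability measure whose density is a normalised bump function. -/
noncomputable def bumpMeasure (ρ : ContDiffBump (0 : E d)) : Measure (E d) :=
  volume.withDensity fun z => ENNReal.ofReal (ρ.normed volume z)

lemma measurable_ofReal_normed (ρ : ContDiffBump (0 : E d)) :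
    Measurable fun z => ENNReal.ofReal (ρ.normed volume z) :=
  ρ.continuous_normed.measurable.ennreal_ofReal

instance (ρ : ContDiffBump (0 : E d)) : IsProbabilityMeasure (bumpMeasure ρ) :=
  ⟨by
    rw [bumpMeasure, withDensity_apply _ MeasurableSet.univ, Measure.restrict_univ,
      ← ofReal_integral_eq_lintegral_ofReal ρ.integrable_normed
        (Eventually.of_forall ρ.nonneg_normed), ρ.integral_normed, ENNReal.ofReal_one]⟩

lemma ae_bumpMeasure_norm_lt (ρ : ContDiffBump (0 : E d)) :
    ∀ᵐ z ∂bumpMeasure ρ, ‖z‖ < ρ.rOut := by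
  rw [bumpMeasure, ae_withDensity_iff (measurable_ofReal_normed ρ)]
  refine Eventually.of_forall fun z hz => ?_
  have h : z ∈ Function.support (ρ.normed volume) := by
    intro h
    simp [h] at hz
  rw [ρ.support_normed_eq] at h
  simpa using h

/-- Mollification as an average of translates over a probability measure, the form to which Jensen's
inequality applies. -/
lemma mollify_eq_integral_bumpMeasure (ρ : ContDiffBump (0 : E d)) (f : E d → G) (p : E d) :
    mollify ρ f p = ∫ z, f (p - z) ∂bumpMeasure ρ := by
  rw [bumpMeasure, integral_withDensity_eq_integral_toReal_smul (measurable_ofReal_normed ρ)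
    (by simp), mollify, ← integral_sub_left_eq_self _ volume p]
  simp [ENNReal.toReal_ofReal (ρ.nonneg_normed _)]

lemma integrable_bumpMeasure (ρ : ContDiffBump (0 : E d)) {f : E d → G}
    (hf : LocallyIntegrable f volume) (p : E d) :
    Integrable (fun z => f (p - z)) (bumpMeasure ρ) := by
  rw [bumpMeasure, integrable_withDensity_iff_integrable_smul' (measurable_ofReal_normed ρ)
    (by simp)]
  have h : Integrable (fun t => ρ.normed volume (p - t) • f t) :=
    hf.integrable_smul_left_of_hasCompactSupport
      (ρ.continuous_normed.comp (continuous_const.sub continuous_id))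
      (ρ.hasCompactSupport_normed.comp_homeomorph (Homeomorph.subLeft p))
  simpa [ENNReal.toReal_ofReal (ρ.nonneg_normed _)] using h.comp_sub_left p

/-- A mollification followed by an affine change of variables is close to the identity in `L²` when
the corresponding translates are. -/
lemma eLpNorm_mollify_sub_le [CompleteSpace G] (ρ : ContDiffBump (0 : E d)) {f : E d → G}
    (hfm : StronglyMeasurable f) (hf : LocallyIntegrable f volume) (r : ℝ) (b : E d) {η : ENNReal}
    (h : ∀ z : E d, ‖z‖ < ρ.rOut →
      eLpNorm (fun x => f (r • x + (b - z)) - f x) 2 volume ≤ η) :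
    eLpNorm (fun x => mollify ρ f (r • x + b) - f x) 2 volume ≤ η := by
  rw [eLpNorm_two_le_iff]
  have hmeas : Measurable fun q : E d × E d => ‖f (r • q.1 + b - q.2) - f q.1‖ₑ ^ 2 := by
    have h1 : StronglyMeasurable fun q : E d × E d => f (r • q.1 + b - q.2) :=
      hfm.comp_measurable (by fun_prop)
    have h2 : StronglyMeasurable fun q : E d × E d => f q.1 :=
      hfm.comp_measurable measurable_fst
    exact (h1.sub h2).enorm.pow_const 2
  calc ∫⁻ x, ‖mollify ρ f (r • x + b) - f x‖ₑ ^ 2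
      ≤ ∫⁻ x, ∫⁻ z, ‖f (r • x + b - z) - f x‖ₑ ^ 2 ∂bumpMeasure ρ := by
        refine lintegral_mono fun x => ?_
        have hint := integrable_bumpMeasure ρ hf (r • x + b)
        have h1 : mollify ρ f (r • x + b) - f x
            = ∫ z, (f (r • x + b - z) - f x) ∂bumpMeasure ρ := by
          rw [integral_sub hint (integrable_const _), mollify_eq_integral_bumpMeasure]
          simp
        rw [h1]
        exact enorm_integral_sq_le (hint.1.sub aestronglyMeasurable_const)
    -- Joint measurability is the reason for asking that `f` itself be strongly measurable.
    _ = ∫⁻ z, (∫⁻ x, ‖f (r • x + b - z) - f x‖ₑ ^ 2) ∂bumpMeasure ρ :=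
        lintegral_lintegral_swap hmeas.aemeasurable
    _ ≤ ∫⁻ _, η ^ 2 ∂bumpMeasure ρ := by
        refine lintegral_mono_ae ?_
        filter_upwards [ae_bumpMeasure_norm_lt ρ] with z hz
        have := eLpNorm_two_le_iff.1 (h z hz)
        simpa only [add_sub_assoc] using this
    _ = η ^ 2 := by simp

/-- The gradient of a mollification is the mollification of the weak gradient. -/
lemma gradient_mollify (ρ : ContDiffBump (0 : E d)) {Ω : Set (E d)}
    {v V : E d → ℝ} {g W : E d → E d} (hv : IsH1 Ω v g) (hV : LocallyIntegrable V volume)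
    (hVv : V =ᵐ[volume.restrict Ω] v) (hWg : W =ᵐ[volume.restrict Ω] g) {p : E d}
    (hp : Metric.closedBall p ρ.rOut ⊆ Ω) :
    gradient (mollify ρ V) p = mollify ρ W p := by
  set ρn := ρ.normed volume with hρn
  have hρs : ContDiff ℝ ((⊤ : ℕ∞) : WithTop ℕ∞) ρn := ρ.contDiff_normed
  have hρ1 : ContDiff ℝ 1 ρn := ρ.contDiff_normed (n := 1)
  have hρc : HasCompactSupport ρn := ρ.hasCompactSupport_normed
  -- The reflected bump is the test function for the weak gradient; its support lies in `Ω` by `hp`,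
  -- so `V` and `W` matter only there.
  set ψ : E d → ℝ := fun t => ρn (p - t) with hψ
  have hψs : ContDiff ℝ ((⊤ : ℕ∞) : WithTop ℕ∞) ψ := hρs.comp (contDiff_const.sub contDiff_id)
  have hψc : HasCompactSupport ψ := hρc.comp_homeomorph (Homeomorph.subLeft p)
  have hψt : tsupport ψ ⊆ Metric.closedBall p ρ.rOut := by
    refine closure_minimal (fun t ht => ?_) Metric.isClosed_closedBall
    have h : p - t ∈ Metric.ball 0 ρ.rOut := by
      rw [← ρ.support_normed_eq (μ := volume)]
      exact ht
    rw [mem_ball_zero_iff, ← dist_eq_norm, dist_comm] at h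
    exact h.le
  have hψg : ∀ t, gradient ψ t = -gradient ρn (p - t) := by
    intro t
    have h1 : HasFDerivAt ψ ((fderiv ℝ ρn (p - t)).comp (-ContinuousLinearMap.id ℝ (E d))) t :=
      ((hρ1.differentiable one_ne_zero).differentiableAt.hasFDerivAt).comp t
        ((hasFDerivAt_id t).const_sub p)
    rw [gradient, h1.fderiv, gradient, ← map_neg]
    congr 1
    ext u
    simp
  have hψ0 : ∀ t ∉ Ω, ψ t = 0 := fun t ht =>
    image_eq_zero_of_notMem_tsupport fun h => ht (hp (hψt h))
  have hψg0 : ∀ t ∉ Ω, gradient ψ t = 0 := by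
    intro t ht
    have h : t ∉ tsupport (fderiv ℝ ψ) := fun h => ht (hp (hψt (tsupport_fderiv_subset ℝ h)))
    rw [gradient, image_eq_zero_of_notMem_tsupport h, map_zero]
  have hweak : ∫ t, V t • gradient ψ t = - ∫ t, ψ t • W t := by
    have h1 : ∫ t in Ω, V t • gradient ψ t = ∫ t, V t • gradient ψ t :=
      setIntegral_eq_integral_of_forall_compl_eq_zero fun t ht => by rw [hψg0 t ht, smul_zero]
    have h2 : ∫ t in Ω, ψ t • W t = ∫ t, ψ t • W t :=
      setIntegral_eq_integral_of_forall_compl_eq_zero fun t ht => by rw [hψ0 t ht, zero_smul]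
    have h3 : ∫ t in Ω, V t • gradient ψ t = ∫ t in Ω, v t • gradient ψ t :=
      integral_congr_ae (hVv.mono fun t ht => by simp only [ht])
    have h4 : ∫ t in Ω, ψ t • W t = ∫ t in Ω, ψ t • g t :=
      integral_congr_ae (hWg.mono fun t ht => by simp only [ht])
    rw [← h1, ← h2, h3, h4]
    exact hv.weak_grad ψ hψs hψc (hψt.trans hp)
  have hmoll : mollify ρ W p = ∫ t, V t • gradient ρn (p - t) := by
    have h : mollify ρ W p = ∫ t, ψ t • W t := rfl
    rw [h, ← neg_eq_iff_eq_neg.2 hweak, ← integral_neg]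
    refine integral_congr_ae (Eventually.of_forall fun t => ?_)
    simp [hψg]
  have hgc : Continuous fun t => gradient ρn (p - t) :=
    (continuous_gradient hρ1).comp (continuous_const.sub continuous_id)
  have hgs : HasCompactSupport fun t => gradient ρn (p - t) := by
    have h : HasCompactSupport (gradient ρn) :=
      (hρc.fderiv (𝕜 := ℝ)).comp_left (g := (InnerProductSpace.toDual ℝ (E d)).symm) (map_zero _)
    exact h.comp_homeomorph (Homeomorph.subLeft p)
  have hint := hV.integrable_smul_right_of_hasCompactSupport hgc hgs
  -- Differentiating the convolution puts the derivative on the bump; the two vectors are compared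
  -- through their inner products with `u`.
  refine ext_inner_left ℝ fun u => ?_
  rw [real_inner_comm, inner_gradient_left, hmoll, ← integral_inner hint,
    mollify_eq_convolution, (hρc.hasFDerivAt_convolution_right _ hV hρ1 p).fderiv,
    convolution_precompR_apply _ hV (hρc.fderiv (𝕜 := ℝ)) (hρ1.continuous_fderiv one_ne_zero)]
  refine integral_congr_ae (Eventually.of_forall fun t => ?_)
  simp [inner_smul_left, real_inner_comm _ u, inner_gradient_left]

end Mollify

end Polytopal

/-! ### Density, traces and passage to the limit. -/

namespace Polytopal

/-! ### Density of smooth functions -/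

lemma contDiff_comp_smul_add {d : ℕ} {f : E d → ℝ} {k : WithTop ℕ∞} (hf : ContDiff ℝ k f) (r : ℝ)
    (b : E d) : ContDiff ℝ k fun x => f (r • x + b) :=
  hf.comp ((contDiff_id.const_smul r).add contDiff_const)

lemma gradient_comp_smul_add {d : ℕ} {f : E d → ℝ} (hf : Differentiable ℝ f) (r : ℝ) (b x : E d) :
    gradient (fun x => f (r • x + b)) x = r • gradient f (r • x + b) := by
  have h1 : HasFDerivAt (fun x : E d => r • x + b) (r • ContinuousLinearMap.id ℝ (E d)) x :=
    ((hasFDerivAt_id x).const_smul r).add_const b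
  have h2 := (hf (r • x + b)).hasFDerivAt.comp x h1
  have h3 : fderiv ℝ (fun x => f (r • x + b)) x = r • fderiv ℝ f (r • x + b) := by
    rw [show (fun x => f (r • x + b)) = f ∘ fun x => r • x + b from rfl, h2.fderiv]
    ext u
    simp
  refine ext_inner_right ℝ fun u => ?_
  rw [inner_gradient_left, h3, real_inner_smul_left, inner_gradient_left]
  rfl

lemma gradient_sub_apply {d : ℕ} {f f' : E d → ℝ} (hf : Differentiable ℝ f)
    (hf' : Differentiable ℝ f') (x : E d) :
    gradient (fun x => f x - f' x) x = gradient f x - gradient f' x := by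
  rw [gradient, gradient, gradient, ← map_sub]
  congr 1
  exact fderiv_sub (hf x) (hf' x)

/-- The bump function of radius `t r / 2` used to mollify at scale `t`. -/
noncomputable def scaledBump {d : ℕ} {r t : ℝ} (hr : 0 < r) (ht : 0 < t) :
    ContDiffBump (0 : E d) where
  rIn := t * r / 4
  rOut := t * r / 2
  rIn_pos := by positivity
  rIn_lt_rOut := by
    have := mul_pos ht hr
    linarith

/-- Each translate involved is an affine change of variables with parameters `(1 - t n, t n • x₀ -
z)`, and these tend to `(1, 0)` uniformly in `z` from the support of the bump. -/
lemma tendsto_eLpNorm_mollify_sub {d : ℕ} {G : Type*} [NormedAddCommGroup G]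
    [NormedSpace ℝ G] [CompleteSpace G] {f : E d → G} (hfm : StronglyMeasurable f)
    (hf : MemLp f 2 volume) (x₀ : E d) {r : ℝ} (hr : 0 < r) {t : ℕ → ℝ} (ht : ∀ n, 0 < t n)
    (ht0 : Tendsto t atTop (𝓝 0)) :
    Tendsto (fun n => eLpNorm (fun x =>
      mollify (scaledBump hr (ht n)) f ((1 - t n) • x + t n • x₀) - f x) 2 volume)
      atTop (𝓝 0) := by
  rw [ENNReal.tendsto_nhds_zero]
  intro ε hε
  obtain ⟨δ, hδ, hclose⟩ := Metric.eventually_nhds_iff.1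
    (ENNReal.tendsto_nhds_zero.1 (tendsto_eLpNorm_comp_smul_add hf) ε hε)
  have hsmall : ∀ᶠ n in atTop, t n * (1 + ‖x₀‖ + r) < δ := by
    have h := ht0.mul_const (1 + ‖x₀‖ + r)
    rw [zero_mul] at h
    exact h.eventually (gt_mem_nhds hδ)
  filter_upwards [hsmall] with n hn
  refine eLpNorm_mollify_sub_le _ hfm (hf.locallyIntegrable (by norm_num)) _ _ fun z hz => ?_
  have h0 := ht n
  have hx0 := mul_nonneg h0.le (norm_nonneg x₀)
  have htr := mul_pos h0 hr
  refine @hclose (1 - t n, t n • x₀ - z) ?_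
  rw [Prod.dist_eq, max_lt_iff, dist_eq_norm, dist_eq_norm]
  constructor
  · rw [sub_sub_cancel_left, norm_neg, Real.norm_of_nonneg h0.le]
    nlinarith
  · rw [sub_zero]
    have h1 := norm_sub_le (t n • x₀) z
    rw [norm_smul, Real.norm_of_nonneg h0.le] at h1
    have h2 : ‖z‖ < t n * r / 2 := hz
    nlinarith

lemma exists_stronglyMeasurable_extension {d : ℕ} {G : Type*} [NormedAddCommGroup G]
    {Ω : Set (E d)} (hΩ : MeasurableSet Ω) {f : E d → G} (hf : MemLp f 2 (volume.restrict Ω)) :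
    ∃ F : E d → G, StronglyMeasurable F ∧ MemLp F 2 volume ∧ F =ᵐ[volume.restrict Ω] f := by
  have h : MemLp (Ω.indicator f) 2 volume := (memLp_indicator_iff_restrict hΩ).2 hf
  refine ⟨h.1.mk _, h.1.stronglyMeasurable_mk, h.ae_eq h.1.ae_eq_mk, ?_⟩
  filter_upwards [ae_restrict_of_ae h.1.ae_eq_mk, indicator_ae_eq_restrict (f := f) hΩ]
    with x h1 h2
  rw [← h1, h2]

/-- Restrictions of smooth functions are dense in `H¹` of a convex open set. -/
lemma exists_contDiff_tendsto {d : ℕ} {Ω : Set (E d)} (hΩ : IsOpen Ω) (hc : Convex ℝ Ω)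
    (hne : Ω.Nonempty) {v : E d → ℝ} {g : E d → E d} (hv : IsH1 Ω v g) :
    ∃ φ : ℕ → E d → ℝ, (∀ n, ContDiff ℝ ((⊤ : ℕ∞) : WithTop ℕ∞) (φ n)) ∧
      Tendsto (fun n => eLpNorm (fun x => φ n x - v x) 2 (volume.restrict Ω)) atTop (𝓝 0) ∧
      Tendsto (fun n => eLpNorm (fun x => gradient (φ n) x - g x) 2 (volume.restrict Ω))
        atTop (𝓝 0) := by
  obtain ⟨x₀, hx₀⟩ := hne
  obtain ⟨r, hr, hball⟩ := Metric.isOpen_iff.1 hΩ x₀ hx₀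
  obtain ⟨V, hVm, hVL, hVv⟩ := exists_stronglyMeasurable_extension hΩ.measurableSet hv.memLp
  obtain ⟨W, hWm, hWL, hWg⟩ := exists_stronglyMeasurable_extension hΩ.measurableSet hv.memLp_grad
  set t : ℕ → ℝ := fun n => 1 / ((n : ℝ) + 1) with ht_def
  have ht : ∀ n, 0 < t n := fun n => by positivity
  have ht1 : ∀ n, t n ≤ 1 := fun n => by
    rw [ht_def, div_le_one (by positivity)]
    linarith [(Nat.cast_nonneg n : (0 : ℝ) ≤ n)]
  have ht0 : Tendsto t atTop (𝓝 0) := tendsto_one_div_add_atTop_nhds_zero_nat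
  have hVloc : LocallyIntegrable V volume := hVL.locallyIntegrable (by norm_num)
  -- Contracting towards `x₀` moves every point of `Ω` inside by more than the mollification radius,
  -- so the zero extension across the boundary of `Ω` does no harm.
  set φ : ℕ → E d → ℝ := fun n x => mollify (scaledBump hr (ht n)) V ((1 - t n) • x + t n • x₀)
    with hφ_def
  have hφ : ∀ n, ContDiff ℝ ((⊤ : ℕ∞) : WithTop ℕ∞) (φ n) := fun n =>
    contDiff_comp_smul_add (contDiff_mollify _ hVloc) _ _
  have hgrad : ∀ n, ∀ x ∈ Ω, gradient (φ n) x
      = (1 - t n) • mollify (scaledBump hr (ht n)) W ((1 - t n) • x + t n • x₀) := by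
    intro n x hx
    rw [hφ_def, gradient_comp_smul_add ((contDiff_mollify _ hVloc).differentiable (by simp)),
      gradient_mollify _ hv hVloc hVv hWg]
    intro y hy
    rw [mem_closedBall_iff_norm] at hy
    have hy' : ‖y - ((1 - t n) • x + t n • x₀)‖ ≤ t n * r / 2 := hy
    set e := y - ((1 - t n) • x + t n • x₀) with he
    -- Then `y = (1 - t) x + t (x₀ + e / t)` is a convex combination of points of `Ω`, as `|e| / t ≤
    -- r / 2 < r`.
    have hmem : x₀ + (t n)⁻¹ • e ∈ Ω := by
      apply hball
      rw [mem_ball_iff_norm, add_sub_cancel_left, norm_smul, norm_inv,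
        Real.norm_of_nonneg (ht n).le, inv_mul_lt_iff₀ (ht n)]
      linarith [mul_pos (ht n) hr]
    have h := hc hx hmem (show 0 ≤ 1 - t n by linarith [ht1 n]) (ht n).le (by ring)
    rw [smul_add, smul_inv_smul₀ (ht n).ne', he] at h
    convert h using 1
    module
  refine ⟨φ, hφ, ?_, ?_⟩
  · refine tendsto_of_tendsto_of_tendsto_of_le_of_le tendsto_const_nhds
      (tendsto_eLpNorm_mollify_sub hVm hVL x₀ hr ht ht0) (fun n => zero_le) fun n => ?_
    calc eLpNorm (fun x => φ n x - v x) 2 (volume.restrict Ω)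
        = eLpNorm (fun x => φ n x - V x) 2 (volume.restrict Ω) :=
          eLpNorm_congr_ae (hVv.mono fun x hx => by simp only [hx])
      _ ≤ eLpNorm (fun x => φ n x - V x) 2 volume :=
          eLpNorm_mono_measure _ Measure.restrict_le_self
  -- The chain rule gives a factor `1 - t n`, whose defect is the extra term `t n • W`.
  · have hlim : Tendsto (fun n => eLpNorm (fun x =>
        mollify (scaledBump hr (ht n)) W ((1 - t n) • x + t n • x₀) - W x) 2 volume
        + ENNReal.ofReal (t n) * eLpNorm W 2 volume) atTop (𝓝 0) := by
      have h1 := ENNReal.Tendsto.mul_const (b := eLpNorm W 2 volume)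
        (ENNReal.tendsto_ofReal ht0) (Or.inr hWL.2.ne)
      simpa using (tendsto_eLpNorm_mollify_sub hWm hWL x₀ hr ht ht0).add h1
    refine tendsto_of_tendsto_of_tendsto_of_le_of_le tendsto_const_nhds hlim
      (fun n => zero_le) fun n => ?_
    have hcont : Continuous (gradient (φ n)) := continuous_gradient ((hφ n).of_le (by simp))
    have hnorm : ‖1 - t n‖ₑ ≤ 1 := by
      rw [Real.enorm_of_nonneg (by linarith [ht1 n]), ENNReal.ofReal_le_one]
      linarith [ht n]
    have hW1 : AEStronglyMeasurable (fun x => (1 - t n) • W x) (volume.restrict Ω) :=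
      (hWm.const_smul (1 - t n)).aestronglyMeasurable
    have hW2 : AEStronglyMeasurable (fun x => t n • W x) (volume.restrict Ω) :=
      (hWm.const_smul (t n)).aestronglyMeasurable
    calc eLpNorm (fun x => gradient (φ n) x - g x) 2 (volume.restrict Ω)
        = eLpNorm ((fun x => gradient (φ n) x - (1 - t n) • W x) - fun x => t n • W x) 2
            (volume.restrict Ω) := by
          refine eLpNorm_congr_ae (hWg.mono fun x hx => ?_)
          simp only [Pi.sub_apply, hx]
          module
      _ ≤ eLpNorm (fun x => gradient (φ n) x - (1 - t n) • W x) 2 (volume.restrict Ω)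
            + eLpNorm (fun x => t n • W x) 2 (volume.restrict Ω) :=
          eLpNorm_sub_le (hcont.aestronglyMeasurable.sub hW1) hW2 (by norm_num)
      _ ≤ _ := by
          refine add_le_add ?_ ?_
          · calc eLpNorm (fun x => gradient (φ n) x - (1 - t n) • W x) 2 (volume.restrict Ω)
                = eLpNorm ((1 - t n) • fun x => mollify (scaledBump hr (ht n)) W
                    ((1 - t n) • x + t n • x₀) - W x) 2 (volume.restrict Ω) := by
                  refine eLpNorm_congr_ae ?_
                  filter_upwards [ae_restrict_mem hΩ.measurableSet] with x hx
                  rw [hgrad n x hx, Pi.smul_apply, smul_sub]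
              _ ≤ eLpNorm (fun x => mollify (scaledBump hr (ht n)) W
                    ((1 - t n) • x + t n • x₀) - W x) 2 (volume.restrict Ω) := by
                  rw [eLpNorm_const_smul]
                  exact mul_le_of_le_one_left' hnorm
              _ ≤ _ := eLpNorm_mono_measure _ Measure.restrict_le_self
          · rw [show (fun x => t n • W x) = t n • W from rfl, eLpNorm_const_smul,
              Real.enorm_of_nonneg (ht n).le]
            gcongr
            exact Measure.restrict_le_self

/-! ### Traces -/

section Trace

variable {m : ℕ} (K : Polytope (m + 1))

lemma hull_nonempty : (hull K).Nonempty :=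
  K.region.interior_nonempty.mono (interior_mono (subset_convexHull ℝ _))

lemma convex_hull : Convex ℝ (hull K) := (convex_convexHull ℝ _).interior

/-- Smooth functions obey a trace inequality on the boundary of a polytope. -/
lemma exists_trace_inequality : ∃ A : ENNReal, A ≠ ⊤ ∧ ∀ φ : E (m + 1) → ℝ, ContDiff ℝ 1 φ →
    eLpNorm φ 2 (boundaryMeasure K) ≤ A * (eLpNorm (gradient φ) 2 (volume.restrict (hull K))
      + eLpNorm φ 2 (volume.restrict (hull K))) := by
  set β := boundaryMeasure K
  set k := volume K.carrier
  have hkt : k ≠ ⊤ := K.isCompact.measure_lt_top.ne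
  have hk0 : k ≠ 0 := K.volume_ne_zero
  set h := ENNReal.ofReal (Metric.diam K.carrier)
  set B : ENNReal := 2 * (K.faces.card * (28 * 2 ^ (m + 1) * β univ * h ^ 2)) + 2 * β univ
  have hβt : β univ ≠ ⊤ := measure_ne_top _ _
  have hBt : B ≠ ⊤ := by finiteness
  have hAt : k⁻¹ * B ≠ ⊤ := ENNReal.mul_ne_top (ENNReal.inv_ne_top.2 hk0) hBt
  refine ⟨k⁻¹ * B + 1, by finiteness, fun φ hφ => ?_⟩
  have hφm : Measurable φ := hφ.continuous.measurable
  set X := eLpNorm (gradient φ) 2 (volume.restrict (hull K)) with hX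
  set Y := eLpNorm φ 2 (volume.restrict (hull K)) with hY
  have hkey : k * eLpNorm φ 2 β ^ 2 ≤ B * (X + Y) ^ 2 := by
    -- Boundary values are compared with all values in `K`, averaged over `x ∈ K`.
    have h1 : ∀ y, k * ‖φ y‖ₑ ^ 2
        ≤ 2 * (∫⁻ x in K.carrier, ‖φ x - φ y‖ₑ ^ 2) + 2 * ∫⁻ x in K.carrier, ‖φ x‖ₑ ^ 2 := by
      intro y
      rw [← lintegral_const_mul _ (by fun_prop), ← lintegral_const_mul _ (by fun_prop),
        ← lintegral_add_left (by fun_prop), mul_comm, ← setLIntegral_const]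
      refine lintegral_mono fun x => ?_
      have := enorm_sub_sq_le (φ y) (φ x) 0
      rwa [sub_zero, sub_zero, ← enorm_neg (φ y - φ x), neg_sub] at this
    calc k * eLpNorm φ 2 β ^ 2 = ∫⁻ y, k * ‖φ y‖ₑ ^ 2 ∂β := by
          rw [eLpNorm_two_sq, lintegral_const_mul _ (by fun_prop)]
      _ ≤ ∫⁻ y, (2 * (∫⁻ x in K.carrier, ‖φ x - φ y‖ₑ ^ 2)
            + 2 * ∫⁻ x in K.carrier, ‖φ x‖ₑ ^ 2) ∂β := lintegral_mono h1
      _ = 2 * (∫⁻ y, ∫⁻ x in K.carrier, ‖φ x - φ y‖ₑ ^ 2 ∂volume ∂β)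
            + 2 * (∫⁻ x in K.carrier, ‖φ x‖ₑ ^ 2) * β univ := by
          rw [lintegral_add_right _ measurable_const, lintegral_const,
            lintegral_const_mul' _ _ (by simp)]
      _ ≤ 2 * (K.faces.card * (28 * 2 ^ (m + 1) * β univ * (h ^ 2 * X ^ 2)))
            + 2 * Y ^ 2 * β univ := by
          gcongr
          · rw [hX, eLpNorm_two_sq]
            exact lintegral_sub_sq_boundary_le K hφ
          · rw [hY, eLpNorm_two_sq]
            exact lintegral_mono' (restrict_carrier_le K) le_rfl
      _ ≤ 2 * (K.faces.card * (28 * 2 ^ (m + 1) * β univ * (h ^ 2 * (X + Y) ^ 2)))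
            + 2 * (X + Y) ^ 2 * β univ := by
          gcongr
          · exact le_self_add
          · exact le_add_self
      _ = B * (X + Y) ^ 2 := by ring
  rw [← ENNReal.pow_le_pow_left_iff two_ne_zero]
  calc eLpNorm φ 2 β ^ 2 = k⁻¹ * (k * eLpNorm φ 2 β ^ 2) := by
        rw [← mul_assoc, ENNReal.inv_mul_cancel hk0 hkt, one_mul]
    _ ≤ k⁻¹ * (B * (X + Y) ^ 2) := by gcongr
    _ = k⁻¹ * B * (X + Y) ^ 2 := by ring
    -- The bound `a ≤ (a + 1) ^ 2` avoids a square root in the constant.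
    _ ≤ (k⁻¹ * B + 1) ^ 2 * (X + Y) ^ 2 := by
        gcongr
        exact le_self_add.trans (le_self_pow₀ le_add_self two_ne_zero)
    _ = ((k⁻¹ * B + 1) * (X + Y)) ^ 2 := by ring

/-- The trace inequality, applied to differences of smooth approximations, makes their restrictions
Cauchy in the complete space `L²(∂K)`. -/
lemma exists_isTrace {v : E (m + 1) → ℝ} {g : E (m + 1) → E (m + 1)} (hv : IsH1 (hull K) v g) :
    ∃ w, IsTrace K v g w := by
  obtain ⟨φ, hφ, hφv, hφg⟩ :=
    exists_contDiff_tendsto isOpen_interior (convex_hull K) (hull_nonempty K) hv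
  obtain ⟨A, hA, htrace⟩ := exists_trace_inequality K
  have hφ1 : ∀ n, ContDiff ℝ 1 (φ n) := fun n => (hφ n).of_le (by simp)
  have hmem : ∀ n, MemLp (φ n) 2 (boundaryMeasure K) := fun n =>
    memLp_boundaryMeasure K (hφ n).continuous
  set c : ℕ → ENNReal := fun n =>
    A * (eLpNorm (fun x => gradient (φ n) x - g x) 2 (volume.restrict (hull K))
      + eLpNorm (fun x => φ n x - v x) 2 (volume.restrict (hull K)))
  have hc : Tendsto c atTop (𝓝 0) := by
    have h := ENNReal.Tendsto.const_mul (a := A) (hφg.add hφv) (Or.inr hA)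
    rw [add_zero, mul_zero] at h
    exact h
  have hdist : ∀ n p, edist ((hmem n).toLp (φ n)) ((hmem p).toLp (φ p)) ≤ c n + c p := by
    intro n p
    rw [Lp.edist_toLp_toLp]
    have hg1 : ∀ n, AEStronglyMeasurable (fun x => gradient (φ n) x - g x)
        (volume.restrict (hull K)) := fun n =>
      (continuous_gradient (hφ1 n)).aestronglyMeasurable.sub hv.memLp_grad.1
    have hv1 : ∀ n, AEStronglyMeasurable (fun x => φ n x - v x) (volume.restrict (hull K)) :=
      fun n => (hφ n).continuous.aestronglyMeasurable.sub hv.memLp.1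
    have h1 : gradient (φ n - φ p)
        = (fun x => gradient (φ n) x - g x) - fun x => gradient (φ p) x - g x := by
      ext1 x
      refine (gradient_sub_apply ((hφ1 n).differentiable one_ne_zero)
        ((hφ1 p).differentiable one_ne_zero) x).trans ?_
      simp
    have h2 : φ n - φ p = (fun x => φ n x - v x) - fun x => φ p x - v x := by
      ext1 x
      simp
    refine (htrace _ ((hφ1 n).sub (hφ1 p))).trans ?_
    calc A * (eLpNorm (gradient (φ n - φ p)) 2 (volume.restrict (hull K))
          + eLpNorm (φ n - φ p) 2 (volume.restrict (hull K)))
        ≤ A * ((eLpNorm (fun x => gradient (φ n) x - g x) 2 (volume.restrict (hull K))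
            + eLpNorm (fun x => gradient (φ p) x - g x) 2 (volume.restrict (hull K)))
          + (eLpNorm (fun x => φ n x - v x) 2 (volume.restrict (hull K))
            + eLpNorm (fun x => φ p x - v x) 2 (volume.restrict (hull K)))) := by
          gcongr
          · rw [h1]
            exact eLpNorm_sub_le (hg1 n) (hg1 p) (by norm_num)
          · rw [h2]
            exact eLpNorm_sub_le (hv1 n) (hv1 p) (by norm_num)
      _ = c n + c p := by ring
  have hcauchy : CauchySeq fun n => (hmem n).toLp (φ n) := by
    rw [EMetric.cauchySeq_iff]
    intro ε hε
    obtain ⟨N, hN⟩ := eventually_atTop.1 (hc.eventually (gt_mem_nhds (ENNReal.half_pos hε.ne')))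
    refine ⟨N, fun n hn p hp => (hdist n p).trans_lt ?_⟩
    rw [← ENNReal.add_halves ε]
    exact ENNReal.add_lt_add (hN n hn) (hN p hp)
  obtain ⟨w, hw⟩ := cauchySeq_tendsto_of_complete hcauchy
  refine ⟨w, Lp.memLp w, φ, hφ, hφv, hφg, ?_⟩
  rw [← Lp.toLp_coeFn w (Lp.memLp w)] at hw
  exact (Lp.tendsto_Lp_iff_tendsto_eLpNorm'' _ hmem _ (Lp.memLp w)).1 hw

/-- Averages over the boundary are continuous in `L²`. -/
lemma enorm_average_sub_average_le {α : Type*} [MeasurableSpace α] {μ : Measure α}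
    [IsFiniteMeasure μ] [NeZero μ] {f w : α → ℝ} (hf : MemLp f 2 μ) (hw : MemLp w 2 μ) :
    ‖(⨍ y, f y ∂μ) - ⨍ y, w y ∂μ‖ₑ
      ≤ ((μ univ)⁻¹ + 1) * eLpNorm (fun x => f x - w x) 2 μ := by
  have hμ : μ univ ≠ 0 := Measure.measure_univ_ne_zero.2 (NeZero.ne _)
  have hf1 : Integrable f ((μ univ)⁻¹ • μ) :=
    (hf.integrable (by norm_num)).smul_measure (ENNReal.inv_ne_top.2 hμ)
  have hw1 : Integrable w ((μ univ)⁻¹ • μ) :=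
    (hw.integrable (by norm_num)).smul_measure (ENNReal.inv_ne_top.2 hμ)
  rw [← ENNReal.pow_le_pow_left_iff two_ne_zero, average, average, ← integral_sub hf1 hw1, mul_pow,
    eLpNorm_two_sq]
  refine (enorm_integral_sq_le (hf1.1.sub hw1.1)).trans ?_
  rw [lintegral_smul_measure, smul_eq_mul]
  refine mul_le_mul' ?_ le_rfl
  exact le_self_add.trans (le_self_pow₀ le_add_self two_ne_zero)

/-- The squared estimate without its squares; the `+ 1` again replaces a square root and keeps the
constant positive. -/
lemma eLpNorm_sub_average_le {N : ℕ} (hN : K.faces.card ≤ N) {φ : E (m + 1) → ℝ}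
    (hφ : ContDiff ℝ 1 φ) :
    eLpNorm (fun x => φ x - ⨍ y, φ y ∂boundaryMeasure K) 2 (volume.restrict K.carrier)
      ≤ ENNReal.ofReal ((N * (28 * 2 ^ (m + 1)) + 1) * Metric.diam K.carrier)
        * eLpNorm (gradient φ) 2 (volume.restrict (hull K)) := by
  rw [eLpNorm_two_le_iff, mul_pow, eLpNorm_two_sq, ENNReal.ofReal_mul (by positivity), mul_pow,
    mul_assoc]
  refine (lintegral_sub_average_sq_le K hφ).trans ?_
  gcongr
  have h : ENNReal.ofReal (N * (28 * 2 ^ (m + 1)) + 1) = N * (28 * 2 ^ (m + 1)) + 1 := by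
    rw [ENNReal.ofReal_add (by positivity) zero_le_one, ENNReal.ofReal_mul (by positivity),
      ENNReal.ofReal_mul (by positivity), ENNReal.ofReal_pow (by positivity)]
    simp
  rw [h]
  calc (K.faces.card : ENNReal) * (28 * 2 ^ (m + 1)) ≤ N * (28 * 2 ^ (m + 1)) := by gcongr
    _ ≤ N * (28 * 2 ^ (m + 1)) + 1 := le_self_add
    _ ≤ (N * (28 * 2 ^ (m + 1)) + 1) ^ 2 := le_self_pow₀ le_add_self two_ne_zero

/-- The Poincaré inequality passes from smooth functions to `H¹`. -/
lemma IsTrace.eLpNorm_sub_average_le {N : ℕ} (hN : K.faces.card ≤ N) {v w : E (m + 1) → ℝ}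
    {g : E (m + 1) → E (m + 1)} (hv : IsH1 (hull K) v g) (hw : IsTrace K v g w) :
    eLpNorm (fun x => v x - ⨍ y, w y ∂boundaryMeasure K) 2 (volume.restrict K.carrier)
      ≤ ENNReal.ofReal ((N * (28 * 2 ^ (m + 1)) + 1) * Metric.diam K.carrier)
        * eLpNorm g 2 (volume.restrict (hull K)) := by
  obtain ⟨hwL, φ, hφ, hφv, hφg, hφw⟩ := hw
  set β := boundaryMeasure K
  set μ := volume.restrict K.carrier
  set c := ENNReal.ofReal ((N * (28 * 2 ^ (m + 1)) + 1) * Metric.diam K.carrier)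
  set s : ENNReal := ((β univ)⁻¹ + 1) * eLpNorm (fun _ : E (m + 1) => (1 : ℝ)) 2 μ
  have hβ : (β univ)⁻¹ ≠ ⊤ := ENNReal.inv_ne_top.2 (Measure.measure_univ_ne_zero.2 (NeZero.ne _))
  have hfin : IsFiniteMeasure μ := ⟨by simpa [μ] using K.isCompact.measure_lt_top⟩
  have hs : s ≠ ⊤ := ENNReal.mul_ne_top (by finiteness) (memLp_const 1).2.ne
  have hφ1 : ∀ n, ContDiff ℝ 1 (φ n) := fun n => (hφ n).of_le (by simp)
  have hvμ : AEStronglyMeasurable v μ := hv.memLp.1.mono_measure (restrict_carrier_le K)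
  -- The approximating sequence is the one that comes with the given `w`, so the result holds for
  -- every trace.
  have hbound : ∀ n, eLpNorm (fun x => v x - ⨍ y, w y ∂β) 2 μ
      ≤ eLpNorm (fun x => φ n x - v x) 2 (volume.restrict (hull K))
        + c * (eLpNorm (fun x => gradient (φ n) x - g x) 2 (volume.restrict (hull K))
          + eLpNorm g 2 (volume.restrict (hull K)))
        + s * eLpNorm (fun x => φ n x - w x) 2 β := by
    intro n
    have hφμ : AEStronglyMeasurable (φ n) μ := (hφ n).continuous.aestronglyMeasurable
    have hsplit : (fun x => v x - ⨍ y, w y ∂β) = (fun x => v x - φ n x)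
        + (fun x => φ n x - ⨍ y, φ n y ∂β)
        + ((⨍ y, φ n y ∂β) - ⨍ y, w y ∂β) • fun _ => (1 : ℝ) := by
      ext x
      simp
    rw [hsplit]
    refine (eLpNorm_add_le ((hvμ.sub hφμ).add (hφμ.sub aestronglyMeasurable_const))
      (aestronglyMeasurable_const.const_smul _) (by norm_num)).trans ?_
    refine add_le_add ((eLpNorm_add_le (hvμ.sub hφμ) (hφμ.sub aestronglyMeasurable_const)
      (by norm_num)).trans (add_le_add ?_ ?_)) ?_
    · refine le_trans (le_of_eq ?_) (eLpNorm_mono_measure _ (restrict_carrier_le K))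
      exact eLpNorm_sub_comm v (φ n) 2 μ
    · refine (Polytopal.eLpNorm_sub_average_le K hN (hφ1 n)).trans ?_
      gcongr
      have h : gradient (φ n) = (fun x => gradient (φ n) x - g x) + g := by
        ext1 x
        simp
      conv_lhs => rw [h]
      exact eLpNorm_add_le ((continuous_gradient (hφ1 n)).aestronglyMeasurable.sub
        hv.memLp_grad.1) hv.memLp_grad.1 (by norm_num)
    · rw [eLpNorm_const_smul]
      calc _ ≤ ((β univ)⁻¹ + 1) * eLpNorm (fun x => φ n x - w x) 2 β
            * eLpNorm (fun _ : E (m + 1) => (1 : ℝ)) 2 μ := by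
            gcongr
            exact enorm_average_sub_average_le (memLp_boundaryMeasure K (hφ n).continuous) hwL
        _ = _ := by ring
  have hlim := (hφv.add (ENNReal.Tendsto.const_mul (a := c)
    (hφg.add_const (eLpNorm g 2 (volume.restrict (hull K)))) (Or.inr ENNReal.ofReal_ne_top))).add
    (ENNReal.Tendsto.const_mul (a := s) hφw (Or.inr hs))
  rw [zero_add, zero_add, mul_zero, add_zero] at hlim
  exact ge_of_tendsto' hlim hbound

end Trace

end Polytopal


theorem lemma3p7 (d : ℕ) (hd : d = 2 ∨ d = 3) (N M : ℕ) (γ : ℝ) (hγ : 0 < γ) :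
    ∃ C : ℝ, 0 < C ∧ ∀ K : Polytopal.Polytope d,
      K.faces.card ≤ N → Polytopal.HeightCondition K γ M →
      ∀ (v : Polytopal.E d → ℝ) (g : Polytopal.E d → Polytopal.E d),
        Polytopal.IsH1 (Polytopal.hull K) v g →
        (∃ w : Polytopal.E d → ℝ, Polytopal.IsTrace K v g w) ∧
        ∀ w : Polytopal.E d → ℝ, Polytopal.IsTrace K v g w →
          eLpNorm (fun x => v x - ⨍ y, w y ∂(Polytopal.boundaryMeasure K)) 2
              (volume.restrict K.carrier)
            ≤ ENNReal.ofReal (C * Metric.diam K.carrier) *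
              eLpNorm g 2 (volume.restrict (Polytopal.hull K)) := by
  obtain ⟨m, rfl⟩ : ∃ m, d = m + 1 := ⟨d - 1, by omega⟩
  -- The height condition is not needed: `Polytopal.volume_slab_le` shows that at least half of `K`
  -- has distance at least `|K| / (4 |∂K|)` from the plane of any face.
  exact ⟨N * (28 * 2 ^ (m + 1)) + 1, by positivity, fun K hN _ v g hv =>
    ⟨Polytopal.exists_isTrace K hv, fun w hw => hw.eLpNorm_sub_average_le K hN hv⟩⟩
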